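/- Let $L>0$, let $\mathbb T=[-L,L]$ be the torus with end points identified, let $\alpha\in\mathbb R$ and $T>0$. For real $s$ let $H^s=H^s(\mathbb T)$ carry the norm $\|f\|_{H^s}^2=2L\sum_{l\in\mathbb Z}\bigl(1+(\pi l/L)^2\bigr)^s|\hat f_l|^2$, where $\hat f_l=\frac1{2L}\int_{-L}^{L}f(x)e^{-i\pi l x/L}\,dx$. Let $U=[-\frac12,\frac12]^{\mathbb N}$ and $U_m=[-\frac12,\frac12]^m$, and write $$\|V\|_{L^\infty(U;H^s)}=\sup_{\xi\in U}\|V(\xi,\cdot)\|_{H^s},\qquad \|\psi\|_{L^\infty((0,T)\times U;H^s)}=\sup_{t\in(0,T),\,\xi\in U}\|\psi(t,\xi,\cdot)\|_{H^s}.$$ There is a function $C:[0,\infty)^2\to(0,\infty)$, depending only on $\alpha$, $T$ and the torus (that is, $L$), such that the following holds for every $s\ge1$. Let $\lambda_1>\lambda_2>\dots>0$, let $v_0,v_1,v_2,\dots$ be real-valued functions in $L^2(\mathbb T)$, and suppose that for every $\xi\in U$ the series $$V(\xi,x)=v_0(x)+\sum_{j=1}^\infty\sqrt{\lambda_j}\,\xi_jv_j(x)$$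 converges in $L^2(\mathbb T)$, and that $\|V\|_{L^\infty(U;H^s)}<\infty$. Let $V_m(\xi,x)=v_0(x)+\sum_{j=1}^m\sqrt{\lambda_j}\,\xi_jv_j(x)$ be its truncations, and let $\psi_{in}\in H^s$ be complex-valued. For every $\xi\in U$ let $\psi(\cdot,\xi,\cdot)$ be a solution on $[0,T]$ of $$i\partial_t\psi=-\tfrac12\partial_x^2\psi+V(\xi,x)\psi+\alpha|\psi|^2\psi,\qquad \psi(0,\xi,x)=\psi_{in}(x),$$ where a solution is an element of $C([0,T];H^1)$ that satisfies the equation on $(0,T)$ in the sense of periodic distributions, i.e. each Fourier coefficient $\hat\psi_l(t)$ is differentiable in $t$ and the $l$-th Fourier coefficients of both sides agree. Then $$\|\psi\|_{L^\infty((0,T)\times U;H^s)}<\infty .$$ If moreover $m\ge 0$ and, for every $\xi\in U_m$, $\psi_m(\cdot,\xi,\cdot)$ is a solution on $[0,T]$, in the same sense, of the dimension-truncated problem $$i\partial_t\psi_m=-\tfrac12\partial_x^2\psi_m+V_m(\xi,x)\psi_m+\alpha|\psi_m|^2\psi_m,\qquad \psi_m(0,\xi,x)=\psi_{in}(x),$$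 then, with $\psi_m(t,\xi,x)$ for $\xi\in U$ understood as $\psi_m(t,(\xi_1,\dots,\xi_m),x)$ and likewise for $V_m$, $$\|\psi_m-\psi\|_{L^\infty((0,T)\times U;H^1)}\le C\bigl(\|V\|_{L^\infty(U;H^s)},\|\psi\|_{L^\infty((0,T)\times U;H^s)}\bigr)\,\|V_m-V\|_{L^\infty(U;H^1)} .$$ In particular the constant does not depend on $m$. -/

import Mathlib

open Set Filter Topology MeasureTheory
open scoped NNReal ENNReal

noncomputable section

/-- The torus `[-L, L]` with its end points identified. -/
abbrev Torus (L : ℝ) : Type := AddCircle (2 * L)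

/-- The wave number `π l / L` of the Fourier mode `x ↦ exp (i π l x / L)` on the torus. -/
def waveNumber (L : ℝ) (l : ℤ) : ℝ := Real.pi * l / L

open Classical in
/-- The norm of the Sobolev space `H^s` of the torus,
`‖f‖² = 2L ∑_l (1 + (π l / L)²)^s |f_l|²`, where `f_l` are the Fourier coefficients of `f`.
It is `∞` if `f` is not in `H^s`; for `s = 1` it is `(‖f‖²_{L²} + ‖∂ₓ f‖²_{L²})^{1/2}`. -/
def sobolevNorm {L : ℝ} [Fact (0 < 2 * L)] (s : ℝ) (f : Torus L → ℂ) : ℝ≥0∞ :=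
  if MemLp f 2 volume then
    (ENNReal.ofReal (2 * L) *
      ∑' l : ℤ, ENNReal.ofReal ((1 + waveNumber L l ^ 2) ^ s * ‖fourierCoeff f l‖ ^ 2)) ^ (1 / 2 : ℝ)
  else ⊤

/-- Membership in the Sobolev space `H^s` of the torus. -/
def MemSobolev {L : ℝ} [Fact (0 < 2 * L)] (s : ℝ) (f : Torus L → ℂ) : Prop :=
  sobolevNorm s f < ⊤

/-- The parameter domain `U = [-1/2, 1/2]^ℕ`. -/
def paramBox : Set (ℕ → ℝ) := {ξ | ∀ j, ξ j ∈ Icc (-(1 / 2) : ℝ) (1 / 2)}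

/-- The truncated parameter domain `U_m = [-1/2, 1/2]^m`. -/
def paramBoxFin (m : ℕ) : Set (Fin m → ℝ) := {ξ | ∀ j, ξ j ∈ Icc (-(1 / 2) : ℝ) (1 / 2)}

/-- The first `m` coordinates of a parameter. -/
def firstCoords (m : ℕ) (ξ : ℕ → ℝ) : Fin m → ℝ := fun j => ξ j

/-- The truncated potential `V_m(ξ, x) = v₀(x) + ∑_{j ≤ m} √λ_j ξ_j v_j(x)`
(the index `j` starts at `0` here). -/
def truncPotential {L : ℝ} (lam : ℕ → ℝ) (v₀ : Torus L → ℝ) (v : ℕ → Torus L → ℝ) (m : ℕ)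
    (ξ : Fin m → ℝ) (x : Torus L) : ℝ :=
  v₀ x + ∑ j : Fin m, Real.sqrt (lam j) * ξ j * v j x

/-- `V(ξ, x) = v₀(x) + ∑_j √λ_j ξ_j v_j(x)` for all `ξ ∈ U`, with strictly decreasing positive
strengths `λ_j` and components in `L²`, the series being convergent in `L²` of the torus. -/
structure IsKLPotential {L : ℝ} [Fact (0 < 2 * L)] (lam : ℕ → ℝ) (v₀ : Torus L → ℝ)
    (v : ℕ → Torus L → ℝ) (V : (ℕ → ℝ) → Torus L → ℝ) : Prop where
  pos : ∀ j, 0 < lam j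
  strictAnti : StrictAnti lam
  memLp_zero : MemLp v₀ 2 volume
  memLp : ∀ j, MemLp (v j) 2 volume
  tendsto : ∀ ξ ∈ paramBox,
    Tendsto (fun m => eLpNorm (truncPotential lam v₀ v m (firstCoords m ξ) - V ξ) 2 volume)
      atTop (𝓝 0)

/-- `u` is a solution on `[0, T]` of `i ∂ₜ u = -½ ∂ₓ² u + W u + α |u|² u`, `u(0) = u₀`, on the
torus: `u` is a continuous curve in `H¹`, and the equation holds in the sense of periodic
distributions, that is, for every Fourier coefficient. -/
structure IsNLSSolution {L : ℝ} [Fact (0 < 2 * L)] (α T : ℝ) (W : Torus L → ℝ)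
    (u₀ : Torus L → ℂ) (u : ℝ → Torus L → ℂ) : Prop where
  mem : ∀ t ∈ Icc 0 T, MemSobolev 1 (u t)
  continuous : ∀ t ∈ Icc 0 T,
    Tendsto (fun τ => sobolevNorm 1 (u τ - u t)) (𝓝[Icc 0 T] t) (𝓝 0)
  initial : u 0 =ᵐ[volume] u₀
  equation : ∀ t ∈ Ioo 0 T, ∀ l : ℤ,
    HasDerivAt (fun τ => fourierCoeff (u τ) l)
      (-Complex.I * ((1 / 2 : ℂ) * (waveNumber L l : ℂ) ^ 2 * fourierCoeff (u t) l
        + fourierCoeff (fun x => (W x : ℂ) * u t x + (α : ℂ) * (‖u t x‖ : ℂ) ^ 2 * u t x) l)) t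

/-- The norm of `L^∞(U; H^s)` as a supremum, for real-valued functions. -/
def supNormU {L : ℝ} [Fact (0 < 2 * L)] (s : ℝ) (V : (ℕ → ℝ) → Torus L → ℝ) : ℝ≥0∞ :=
  ⨆ ξ ∈ paramBox, sobolevNorm s (fun x => (V ξ x : ℂ))

/-- The norm of `L^∞((0,T) × U; H^s)` as a supremum. -/
def supNormTU {L : ℝ} [Fact (0 < 2 * L)] (T s : ℝ) (ψ : ℝ → (ℕ → ℝ) → Torus L → ℂ) : ℝ≥0∞ :=
  ⨆ t ∈ Ioo 0 T, ⨆ ξ ∈ paramBox, sobolevNorm s (ψ t ξ)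

end

noncomputable section

/-! Everything is measured by weighted `ℓ²` norms of Fourier coefficients. If `w (k + j) ≤ c * max
(w k) (w j)`, Young's inequality gives a tame product bound (`weightedNorm_mul_le`), and `H^{3/4}`
embeds into the Wiener algebra. The free flow only rotates each Fourier coefficient, so Gronwall
(`IsSobolevCurve.weightedNorm_le_gronwall`) turns bounds on the nonlinearity into Lipschitz
dependence on the potential (`IsNLSSolution.weightedNorm_sub_le`) and into propagation of regularity
(`IsNLSSolution.weightedNorm_le`).

The delicate point is uniformity in `ξ`, obtained by compactness of the box in the product topology
rather than by conservation laws. Convergence of the series for all choices of signs forces absolute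
summability of each of its Fourier coefficients, so these depend continuously on `ξ`; together with
the `H¹` bound this makes `V` continuous into `H^{3/4}`. A bootstrap bounds the solutions in
`H^{3/4}` near each parameter, and a finite cover finishes (`IsKLPotential.exists_uniform_bound`).
Tameness lifts the resulting Wiener bound to `H^s`: weights capped at `N` are finite along `H¹`
curves, and the estimate does not depend on `N`.

For the comparison, `V_m` at `ξ` is `V` at the extension of `ξ` by zero. By uniqueness `ψ_m` is then
a value of `ψ` and inherits its bounds, so stability in `H¹` has a constant free of `m`; it is free
of `s` because only `H¹ ≤ H^s` is used. -/

/-- The `ℓ²` norm of a sequence of extended nonnegative reals. -/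
def ell2Norm {ι : Type*} (a : ι → ℝ≥0∞) : ℝ≥0∞ := (∑' l, a l ^ 2) ^ (1 / 2 : ℝ)

/-! ### Minkowski, Cauchy–Schwarz and Young inequalities for sequences -/

section Ell2

variable {ι : Type*} {a b : ι → ℝ≥0∞}

theorem ell2Norm_sq (a : ι → ℝ≥0∞) : ell2Norm a ^ 2 = ∑' l, a l ^ 2 := by
  rw [ell2Norm, ← ENNReal.rpow_natCast, ← ENNReal.rpow_mul]
  norm_num

theorem ell2Norm_le_of_sq_le {c : ℝ≥0∞} (h : ∑' l, a l ^ 2 ≤ c ^ 2) : ell2Norm a ≤ c := by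
  rw [← ell2Norm_sq] at h
  exact (ENNReal.pow_le_pow_left_iff two_ne_zero).1 h

theorem ell2Norm_mono (h : ∀ l, a l ≤ b l) : ell2Norm a ≤ ell2Norm b :=
  ENNReal.rpow_le_rpow (ENNReal.tsum_le_tsum fun l => by gcongr; exact h l) (by norm_num)

theorem ell2Norm_const_mul (c : ℝ≥0∞) (a : ι → ℝ≥0∞) :
    ell2Norm (fun l => c * a l) = c * ell2Norm a := by
  have : ∑' l, (c * a l) ^ 2 = c ^ 2 * ∑' l, a l ^ 2 := by
    simp_rw [mul_pow, ENNReal.tsum_mul_left]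
  rw [ell2Norm, this, ENNReal.mul_rpow_of_nonneg _ _ (by norm_num), ← ENNReal.rpow_natCast,
    ← ENNReal.rpow_mul]
  norm_num [ell2Norm]

theorem ell2Norm_add_le (a b : ι → ℝ≥0∞) :
    ell2Norm (fun l => a l + b l) ≤ ell2Norm a + ell2Norm b := by
  -- With the top σ-algebra every sequence is measurable, so this is Minkowski's inequality in `L²`
  -- of the counting measure.
  let _ : MeasurableSpace ι := ⊤
  have := ENNReal.lintegral_Lp_add_le (μ := Measure.count) (p := 2) (f := a) (g := b)
    measurable_from_top.aemeasurable measurable_from_top.aemeasurable (by norm_num)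
  simpa [lintegral_count, ell2Norm] using this

theorem tsum_mul_sq_le (a b : ι → ℝ≥0∞) :
    ∑' l, a l * b l ≤ ell2Norm a * ell2Norm b := by
  let _ : MeasurableSpace ι := ⊤
  have := ENNReal.lintegral_mul_le_Lp_mul_Lq (Measure.count) (p := 2) (q := 2) (f := a) (g := b)
    (by rw [Real.holderConjugate_iff]; norm_num)
    measurable_from_top.aemeasurable measurable_from_top.aemeasurable
  simpa [lintegral_count, ell2Norm] using this

theorem le_ell2Norm (a : ι → ℝ≥0∞) (l : ι) : a l ≤ ell2Norm a := by
  rw [← ENNReal.pow_le_pow_left_iff two_ne_zero, ell2Norm_sq]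
  exact ENNReal.le_tsum l

theorem ell2Norm_le_of_finset {c : ℝ≥0∞} (h : ∀ F : Finset ι, ∑ l ∈ F, a l ^ 2 ≤ c ^ 2) :
    ell2Norm a ≤ c := by
  refine ell2Norm_le_of_sq_le ?_
  rw [ENNReal.tsum_eq_iSup_sum]
  exact iSup_le h

theorem tsum_tsum_mul_sub {a b : ℤ → ℝ≥0∞} :
    ∑' l, ∑' k, a k * b (l - k) = (∑' k, a k) * ∑' k, b k := by
  rw [ENNReal.tsum_comm]
  simp_rw [ENNReal.tsum_mul_left]
  rw [← ENNReal.tsum_mul_right]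
  exact tsum_congr fun k => congrArg _ ((Equiv.subRight k).tsum_eq b)

/-- **Young's inequality** `ℓ¹ * ℓ² ⊆ ℓ²` on the integers. -/
theorem ell2Norm_conv_le (a b : ℤ → ℝ≥0∞) :
    ell2Norm (fun l => ∑' k, a k * b (l - k)) ≤ (∑' k, a k) * ell2Norm b := by
  -- Cauchy–Schwarz after splitting `a = a^{1/2} * a^{1/2}`; summing over `l` then only needs the
  -- `ℓ¹ * ℓ¹` convolution identity.
  have key : ∀ l, (∑' k, a k * b (l - k)) ^ 2 ≤ (∑' k, a k) * ∑' k, a k * b (l - k) ^ 2 := by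
    intro l
    have h := tsum_mul_sq_le (fun k => a k ^ (1 / 2 : ℝ)) (fun k => a k ^ (1 / 2 : ℝ) * b (l - k))
    have hs : ∀ x : ℝ≥0∞, x ^ (1 / 2 : ℝ) * x ^ (1 / 2 : ℝ) = x := fun x => by
      rw [← ENNReal.rpow_add_of_nonneg _ _ (by norm_num) (by norm_num)]; norm_num
    simp_rw [← mul_assoc, hs] at h
    calc (∑' k, a k * b (l - k)) ^ 2 ≤ (ell2Norm (fun k => a k ^ (1 / 2 : ℝ)) *
          ell2Norm fun k => a k ^ (1 / 2 : ℝ) * b (l - k)) ^ 2 := by gcongr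
      _ = _ := by
        rw [mul_pow, ell2Norm_sq, ell2Norm_sq]
        simp_rw [mul_pow, sq (_ ^ (1 / 2 : ℝ)), hs]
  refine ell2Norm_le_of_sq_le ?_
  calc _ ≤ ∑' l, (∑' k, a k) * ∑' k, a k * b (l - k) ^ 2 := ENNReal.tsum_le_tsum key
    _ = _ := by
      rw [ENNReal.tsum_mul_left, tsum_tsum_mul_sub (b := fun j => b j ^ 2), mul_pow, ell2Norm_sq,
        sq, mul_assoc]

end Ell2

/-! ### Fourier coefficients of products and the Wiener algebra -/

section Fourier

variable {P : ℝ} [hP : Fact (0 < P)] {f g : AddCircle P → ℂ}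

open AddCircle ComplexConjugate

theorem integrable_of_memLp_two (hf : MemLp f 2 volume) :
    Integrable f haarAddCircle :=
  hf.haarAddCircle.integrable (by norm_num)

theorem fourierCoeff_congr_volume (h : f =ᵐ[volume] g) : fourierCoeff f = fourierCoeff g :=
  fourierCoeff_congr_ae (by
    have : (volume : Measure (AddCircle P)) = ENNReal.ofReal P • haarAddCircle := rfl
    rw [this] at h
    exact (Measure.ae_ennreal_smul_measure_iff (by simpa using hP.out)).1 h)

theorem fourierCoeff_sub (hf : MemLp f 2 volume) (hg : MemLp g 2 volume) (l : ℤ) :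
    fourierCoeff (f - g) l = fourierCoeff f l - fourierCoeff g l := by
  have := congrFun (fourierCoeff.add (integrable_of_memLp_two hf)
    (integrable_of_memLp_two hg.neg)) l
  have h2 := fourierCoeff.const_smul g (-1) l
  rw [neg_one_smul] at h2
  rw [sub_eq_add_neg, this, Pi.add_apply, h2]; simp [sub_eq_add_neg]

theorem fourierCoeff_conj (f : AddCircle P → ℂ) (l : ℤ) :
    fourierCoeff (fun x => conj (f x)) l = conj (fourierCoeff f (-l)) := by
  simp only [fourierCoeff, neg_neg, smul_eq_mul]
  rw [← integral_conj]
  simp only [map_mul, fourier_neg]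

theorem fourierCoeff_coeFn_toLp (hf : MemLp f 2 haarAddCircle) :
    fourierCoeff (hf.toLp f) = fourierCoeff f :=
  fourierCoeff_congr_ae hf.coeFn_toLp

/-- The Fourier coefficients of a product are the convolution of the Fourier coefficients. -/
theorem hasSum_fourierCoeff_mul (hf : MemLp f 2 volume) (hg : MemLp g 2 volume) (l : ℤ) :
    HasSum (fun k => fourierCoeff f k * fourierCoeff g (l - k))
      (fourierCoeff (fun x => f x * g x) l) := by
  have hf' := hf.haarAddCircle
  -- Parseval is applied to the pairing of `f` with `e_l * conj g`: the inner product is the `l`-th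
  -- coefficient of `f * g`, and the `k`-th coefficient of the second factor is, up to conjugation,
  -- that of `g` at `l - k`.
  have hG : MemLp (fun x => fourier l x * conj (g x)) 2 haarAddCircle := by
    have h1 := (hg.haarAddCircle).star
    refine h1.of_le (by
      exact ((map_continuous (fourier l)).aestronglyMeasurable).mul h1.1) (ae_of_all _ fun x => ?_)
    simp [Circle.norm_coe]
  have h := fourierBasis.hasSum_inner_mul_inner (hG.toLp _) (hf'.toLp f)
  have e1 : ∀ k, inner ℂ (fourierBasis k) (hf'.toLp f) = fourierCoeff f k := fun k => by
    rw [← fourierBasis.repr_apply_apply, fourierBasis_repr, fourierCoeff_coeFn_toLp hf']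
  have e2 : ∀ k, inner ℂ (hG.toLp _) (fourierBasis k) = fourierCoeff g (l - k) := fun k => by
    rw [← inner_conj_symm, ← fourierBasis.repr_apply_apply, fourierBasis_repr,
      fourierCoeff_coeFn_toLp hG]
    simp only [fourierCoeff, smul_eq_mul]
    rw [← integral_conj]
    refine integral_congr_ae (ae_of_all _ fun x => ?_)
    simp only [map_mul, ← fourier_neg, Complex.conj_conj, ← mul_assoc, ← fourier_add]
    congr 3; ring
  have e3 : inner ℂ (hG.toLp _) (hf'.toLp f) = fourierCoeff (fun x => f x * g x) l := by
    rw [L2.inner_def, fourierCoeff]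
    refine integral_congr_ae ?_
    filter_upwards [hG.coeFn_toLp, hf'.coeFn_toLp] with x hx hy
    rw [hx, hy, RCLike.inner_apply, fourier_neg]
    simp only [map_mul, Complex.conj_conj, smul_eq_mul]
    ring
  rw [e3] at h
  simpa only [e1, e2, mul_comm (fourierCoeff g _)] using h

/-- The norm of the Wiener algebra. -/
def wienerNorm (f : AddCircle P → ℂ) : ℝ≥0∞ := ∑' l, ‖fourierCoeff f l‖ₑ

/-- The `ℓ²` norm of the Fourier coefficients with weight `w`. -/
def weightedNorm (w : ℤ → ℝ≥0) (f : AddCircle P → ℂ) : ℝ≥0∞ :=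
  ell2Norm fun l => w l * ‖fourierCoeff f l‖ₑ

theorem enorm_fourierCoeff_mul_le (hf : MemLp f 2 volume) (hg : MemLp g 2 volume) (l : ℤ) :
    ‖fourierCoeff (fun x => f x * g x) l‖ₑ
      ≤ ∑' k, ‖fourierCoeff f k‖ₑ * ‖fourierCoeff g (l - k)‖ₑ := by
  rw [← (hasSum_fourierCoeff_mul hf hg l).tsum_eq]
  refine (enorm_tsum_le_tsum_enorm).trans_eq ?_
  simp_rw [enorm_mul]

theorem wienerNorm_mul_le (hf : MemLp f 2 volume) (hg : MemLp g 2 volume) :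
    wienerNorm (fun x => f x * g x) ≤ wienerNorm f * wienerNorm g := by
  rw [wienerNorm, wienerNorm, wienerNorm, ← tsum_tsum_mul_sub]
  exact ENNReal.tsum_le_tsum (enorm_fourierCoeff_mul_le hf hg)

theorem wienerNorm_conj (f : AddCircle P → ℂ) : wienerNorm (fun x => conj (f x)) = wienerNorm f := by
  simp only [wienerNorm, fourierCoeff_conj, RCLike.enorm_conj]
  exact (Equiv.neg ℤ).tsum_eq fun l => ‖fourierCoeff f l‖ₑ

/-- A square integrable function with absolutely summable Fourier coefficients is essentially
bounded. -/
theorem memLp_top_of_wienerNorm (hf : MemLp f 2 volume) (h : wienerNorm f ≠ ⊤) :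
    MemLp f ⊤ volume := by
  have hf' := hf.haarAddCircle
  have hs : Summable fun i => ‖fourierCoeff f i‖ := by
    have := ENNReal.summable_toReal h
    simpa using this
  have hs' : Summable fun i => fourierCoeff f i • (fourier i : C(AddCircle P, ℂ)) :=
    .of_norm (by simpa [norm_smul, fourier_norm] using hs)
  obtain ⟨F, hF⟩ := hs'
  have h1 := hF.mapL (ContinuousMap.toLp 2 haarAddCircle ℂ (E := ℂ))
  have h2 := hasSum_fourier_series_L2 (hf'.toLp f)
  -- The uniform limit `F` and `f` are sums of the same Fourier series in `L²`, hence agree almost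
  -- everywhere.
  simp only [map_smul] at h1
  rw [fourierCoeff_coeFn_toLp hf'] at h2
  have h3 := h2.unique h1
  have h4 : f =ᵐ[haarAddCircle] F := by
    refine hf'.coeFn_toLp.symm.trans ?_
    rw [h3]
    exact ContinuousMap.coeFn_toLp haarAddCircle F
  have h5 : MemLp F ⊤ (haarAddCircle : Measure (AddCircle P)) :=
    memLp_top_of_bound F.continuous.aestronglyMeasurable ‖F‖ (ae_of_all _ F.norm_coe_le_norm)
  exact ((memLp_congr_ae h4).2 h5).of_haarAddCircle

end Fourier

/-! ### Algebra weights and tame product estimates -/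

section Weights

variable {P : ℝ} [hP : Fact (0 < P)] {f g h : AddCircle P → ℂ} {c : ℝ≥0} {w : ℤ → ℝ≥0}

open AddCircle ComplexConjugate

/-- Even weights on the frequencies for which the weighted spaces are algebras. -/
structure IsAlgebraWeight (c : ℝ≥0) (w : ℤ → ℝ≥0) : Prop where
  one_le : 1 ≤ c
  even : ∀ l, w (-l) = w l
  le_max : ∀ k j, w (k + j) ≤ c * max (w k) (w j)

theorem weightedNorm_congr (w : ℤ → ℝ≥0) (h : f =ᵐ[volume] g) :
    weightedNorm w f = weightedNorm w g := by
  rw [weightedNorm, weightedNorm, fourierCoeff_congr_volume h]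

theorem wienerNorm_congr (h : f =ᵐ[volume] g) : wienerNorm f = wienerNorm g := by
  rw [wienerNorm, wienerNorm, fourierCoeff_congr_volume h]

theorem weightedNorm_mono {w₁ w₂ : ℤ → ℝ≥0} (h : ∀ l, w₁ l ≤ w₂ l) (f : AddCircle P → ℂ) :
    weightedNorm w₁ f ≤ weightedNorm w₂ f :=
  ell2Norm_mono fun l => by gcongr; exact h l

theorem weightedNorm_conj (hw : IsAlgebraWeight c w) (f : AddCircle P → ℂ) :
    weightedNorm w (fun x => conj (f x)) = weightedNorm w f := by
  simp only [weightedNorm, ell2Norm, fourierCoeff_conj, RCLike.enorm_conj]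
  congr 1
  rw [← (Equiv.neg ℤ).tsum_eq]
  simp [hw.even]

theorem weightedNorm_sub_comm (w : ℤ → ℝ≥0) (hf : MemLp f 2 volume) (hg : MemLp g 2 volume) :
    weightedNorm w (f - g) = weightedNorm w (g - f) := by
  simp only [weightedNorm, fourierCoeff_sub hf hg, fourierCoeff_sub hg hf, enorm_sub_rev]

theorem weightedNorm_le_add_sub (w : ℤ → ℝ≥0) (hf : MemLp f 2 volume) (hg : MemLp g 2 volume) :
    weightedNorm w f ≤ weightedNorm w g + weightedNorm w (f - g) := by
  refine le_trans (ell2Norm_mono fun l => ?_) (ell2Norm_add_le _ _)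
  rw [fourierCoeff_sub hf hg, ← mul_add]
  gcongr
  calc _ = ‖fourierCoeff g l + (fourierCoeff f l - fourierCoeff g l)‖ₑ := by congr 1; ring
    _ ≤ _ := enorm_add_le _ _

theorem weightedNorm_sub_le (w : ℤ → ℝ≥0) (hf : MemLp f 2 volume) (hg : MemLp g 2 volume) :
    weightedNorm w (f - g) ≤ weightedNorm w f + weightedNorm w g := by
  refine le_trans (ell2Norm_mono fun l => ?_) (ell2Norm_add_le _ _)
  rw [fourierCoeff_sub hf hg, ← mul_add]
  gcongr
  exact enorm_sub_le

/-- The tame product estimate. -/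
theorem weightedNorm_mul_le (hw : IsAlgebraWeight c w) (hf : MemLp f 2 volume)
    (hg : MemLp g 2 volume) :
    weightedNorm w (fun x => f x * g x)
      ≤ c * (weightedNorm w f * wienerNorm g + wienerNorm f * weightedNorm w g) := by
  have h1 : ∀ l, (w l : ℝ≥0∞) * ‖fourierCoeff (fun x => f x * g x) l‖ₑ ≤
      c * (∑' k, ‖fourierCoeff g k‖ₑ * (w (l - k) * ‖fourierCoeff f (l - k)‖ₑ)
        + ∑' k, ‖fourierCoeff f k‖ₑ * (w (l - k) * ‖fourierCoeff g (l - k)‖ₑ)) := by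
    intro l
    -- Reindexing by `k ↦ l - k` puts the weighted factor at `l - k` in both sums, the shape
    -- required by Young's inequality.
    rw [← (Equiv.subLeft l).tsum_eq
      (fun k => ‖fourierCoeff g k‖ₑ * (w (l - k) * ‖fourierCoeff f (l - k)‖ₑ)),
      ← ENNReal.tsum_add, ← ENNReal.tsum_mul_left]
    refine (mul_le_mul_right (enorm_fourierCoeff_mul_le hf hg l) _).trans ?_
    rw [← ENNReal.tsum_mul_left]
    refine ENNReal.tsum_le_tsum fun k => ?_
    have hk : (w l : ℝ≥0∞) ≤ c * (w k + w (l - k)) := by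
      have := hw.le_max k (l - k)
      rw [add_sub_cancel] at this
      have h2 : max (w k) (w (l - k)) ≤ w k + w (l - k) := by
        simp
      exact_mod_cast this.trans (by gcongr)
    calc _ ≤ c * ((w k : ℝ≥0∞) + w (l - k)) *
          (‖fourierCoeff f k‖ₑ * ‖fourierCoeff g (l - k)‖ₑ) := by gcongr
      _ = _ := by simp only [Equiv.subLeft_apply, sub_sub_cancel]; ring
  refine (ell2Norm_mono h1).trans ?_
  rw [ell2Norm_const_mul]
  gcongr
  refine (ell2Norm_add_le _ _).trans ?_
  refine add_le_add ?_ ?_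
  · rw [mul_comm (weightedNorm w f)]
    exact ell2Norm_conv_le _ fun k => w k * ‖fourierCoeff f k‖ₑ
  · exact ell2Norm_conv_le _ fun k => w k * ‖fourierCoeff g k‖ₑ

/-- Square integrable functions with absolutely summable Fourier coefficients. -/
structure InWiener (f : AddCircle P → ℂ) : Prop where
  memLp : MemLp f 2 volume
  ne_top : wienerNorm f ≠ ⊤

/-- Square integrability survives because the first factor is essentially bounded. -/
theorem InWiener.mul (hf : InWiener f) (hg : InWiener g) : InWiener fun x => f x * g x where
  memLp := hg.memLp.mul' (memLp_top_of_wienerNorm hf.memLp hf.ne_top)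
  ne_top := ((wienerNorm_mul_le hf.memLp hg.memLp).trans_lt
    (ENNReal.mul_lt_top hf.ne_top.lt_top hg.ne_top.lt_top)).ne

theorem InWiener.conj (hf : InWiener f) : InWiener fun x => conj (f x) where
  memLp := hf.memLp.star
  ne_top := by rw [wienerNorm_conj]; exact hf.ne_top

theorem InWiener.sub (hf : InWiener f) (hg : InWiener g) : InWiener (f - g) where
  memLp := hf.memLp.sub hg.memLp
  ne_top := by
    refine ne_top_of_le_ne_top (b := wienerNorm f + wienerNorm g)
      (ENNReal.add_ne_top.2 ⟨hf.ne_top, hg.ne_top⟩) ?_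
    rw [wienerNorm, wienerNorm, wienerNorm, ← ENNReal.tsum_add]
    refine ENNReal.tsum_le_tsum fun l => ?_
    rw [fourierCoeff_sub hf.memLp hg.memLp]
    exact enorm_sub_le

theorem weightedNorm_mul_mul_le (hw : IsAlgebraWeight c w) (hf : InWiener f) (hg : InWiener g)
    (hh : InWiener h) :
    weightedNorm w (fun x => f x * g x * h x)
      ≤ c ^ 2 * (weightedNorm w f * wienerNorm g * wienerNorm h
        + wienerNorm f * weightedNorm w g * wienerNorm h
        + wienerNorm f * wienerNorm g * weightedNorm w h) := by
  have h1 := weightedNorm_mul_le hw (hf.mul hg).memLp hh.memLp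
  have h2 := weightedNorm_mul_le hw hf.memLp hg.memLp
  have h3 := wienerNorm_mul_le hf.memLp hg.memLp
  -- The last term picks up only one factor `c`; `1 ≤ c` lets all three share `c ^ 2`.
  have hc : (1 : ℝ≥0∞) ≤ c := by exact_mod_cast hw.one_le
  calc _ ≤ _ := h1
    _ ≤ c * (c * (weightedNorm w f * wienerNorm g + wienerNorm f * weightedNorm w g) * wienerNorm h
        + c * (wienerNorm f * wienerNorm g * weightedNorm w h)) := by
      refine mul_le_mul_right (add_le_add (by gcongr) ?_) _
      calc _ ≤ 1 * (wienerNorm f * wienerNorm g * weightedNorm w h) := by rw [one_mul]; gcongr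
        _ ≤ _ := by gcongr
    _ = _ := by ring

/-- The condition on a weight under which the weighted space embeds into the Wiener algebra. -/
def EmbedsInWiener (K : ℝ≥0) (w : ℤ → ℝ≥0) : Prop := ell2Norm (fun l => ((w l : ℝ≥0∞))⁻¹) ≤ K

/-- Cauchy–Schwarz after inserting `w⁻¹ * w`. A zero of the weight is impossible, since its inverse
would be `⊤`. -/
theorem wienerNorm_le {K : ℝ≥0} (hK : EmbedsInWiener K w) (f : AddCircle P → ℂ) :
    wienerNorm f ≤ K * weightedNorm w f := by
  have hw : ∀ l, w l ≠ 0 := fun l h => by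
    have := (le_ell2Norm (fun l => ((w l : ℝ≥0∞))⁻¹) l).trans hK
    simp [h] at this
  calc wienerNorm f = ∑' l, (w l : ℝ≥0∞)⁻¹ * (w l * ‖fourierCoeff f l‖ₑ) := by
        refine tsum_congr fun l => ?_
        rw [← mul_assoc, ENNReal.inv_mul_cancel (by simpa using hw l) (by simp), one_mul]
    _ ≤ _ := tsum_mul_sq_le _ _
    _ ≤ _ := by gcongr; exacts [hK, le_rfl]

end Weights

/-! ### Sobolev weights -/

section Sobolev

variable (L : ℝ)

/-- The weight `(1 + (π l / L)²)^(s/2)` of the Sobolev space `H^s`. -/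
def sobolevWeight (s : ℝ) (l : ℤ) : ℝ≥0 := (1 + (waveNumber L l ^ 2).toNNReal) ^ (s / 2)

theorem one_le_sobolevWeight {s : ℝ} (hs : 0 ≤ s) (l : ℤ) : 1 ≤ sobolevWeight L s l :=
  NNReal.one_le_rpow le_self_add (by positivity)

theorem sobolevWeight_mono {s r : ℝ} (h : s ≤ r) (l : ℤ) :
    sobolevWeight L s l ≤ sobolevWeight L r l :=
  NNReal.rpow_le_rpow_of_exponent_le le_self_add (by linarith)

/-- From `(x + y)² ≤ 2x² + 2y²` the base of the weight grows by at most a factor `4` over the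
maximum; the constant is this factor to the power `s / 2`. -/
theorem sobolevWeight_isAlgebraWeight {s : ℝ} (hs : 0 ≤ s) :
    IsAlgebraWeight (4 ^ (s / 2)) (sobolevWeight L s) where
  one_le := NNReal.one_le_rpow (by norm_num) (by positivity)
  even l := by simp [sobolevWeight, waveNumber, neg_div]
  le_max k j := by
    have h : 1 + (waveNumber L (k + j) ^ 2).toNNReal
        ≤ 4 * max (1 + (waveNumber L k ^ 2).toNNReal) (1 + (waveNumber L j ^ 2).toNNReal) := by
      rw [← NNReal.coe_le_coe]
      push_cast [Real.coe_toNNReal _ (sq_nonneg _)]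
      have e : waveNumber L (k + j) = waveNumber L k + waveNumber L j := by
        simp only [waveNumber]; push_cast; ring
      rw [e]
      have h1 := le_max_left (1 + waveNumber L k ^ 2) (1 + waveNumber L j ^ 2)
      have h2 := le_max_right (1 + waveNumber L k ^ 2) (1 + waveNumber L j ^ 2)
      nlinarith [sq_nonneg (waveNumber L k - waveNumber L j)]
    have hm : Monotone fun x : ℝ≥0 => x ^ (s / 2) := fun x y hxy =>
      NNReal.rpow_le_rpow hxy (by positivity)
    refine (hm h).trans ?_
    simp only [NNReal.mul_rpow]
    exact mul_le_mul_right (hm.map_max).le _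

/-- Capping keeps the same constant `c`, so estimates with capped weights are uniform in the cap
`N`. -/
theorem IsAlgebraWeight.min {c : ℝ≥0} {w : ℤ → ℝ≥0} (hw : IsAlgebraWeight c w) (N : ℝ≥0) :
    IsAlgebraWeight c fun l => min (w l) N where
  one_le := hw.one_le
  even l := by simp [hw.even]
  le_max k j := by
    rw [← min_max_distrib_right]
    refine le_trans (min_le_min_right N (hw.le_max k j)) ?_
    rcases le_total (max (w k) (w j)) N with h | h
    · rw [min_eq_left h]; exact min_le_left _ _
    · rw [min_eq_right h]
      exact (min_le_right _ _).trans (le_mul_of_one_le_left zero_le hw.one_le)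

/-- The inverse squared weight decays like `|l|^{-3/2}`. The exponent `3/4` lies above `1/2` for
this summability and below `1` to leave room for compactness from `H¹` bounds. -/
theorem exists_embedsInWiener {L : ℝ} (hL : 0 < L) :
    ∃ K : ℝ≥0, EmbedsInWiener K (sobolevWeight L (3 / 4)) := by
  have hs : Summable fun l : ℤ => (sobolevWeight L (3 / 4) l)⁻¹ ^ 2 := by
    rw [← NNReal.summable_coe]
    refine Summable.of_norm_bounded_eventually
      ((Real.summable_abs_int_rpow (b := 3 / 2) (by norm_num)).mul_left
        ((Real.pi / L) ^ (-(3 / 2) : ℝ)))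
      ?_
    -- At `l = 0` the majorant is `0`, so this frequency is left out of the comparison.
    rw [eventually_cofinite]
    refine (finite_singleton (0 : ℤ)).subset fun l hl => ?_
    by_contra h0
    apply hl
    have hl0 : (l : ℝ) ≠ 0 := by exact_mod_cast h0
    have hx : 0 < Real.pi / L * |(l : ℝ)| := by positivity
    rw [NNReal.coe_pow, NNReal.coe_inv, sobolevWeight, NNReal.coe_rpow]
    push_cast [Real.coe_toNNReal _ (sq_nonneg _)]
    have e : waveNumber L l ^ 2 = (Real.pi / L * |(l : ℝ)|) ^ 2 := by
      rw [mul_pow, sq_abs, waveNumber]; ring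
    rw [e, ← Real.mul_rpow (by positivity) (by positivity)]
    set x := Real.pi / L * |(l : ℝ)|
    have h1 : (0 : ℝ) < 1 + x ^ 2 := by positivity
    have h2 : (((1 + x ^ 2) ^ (3 / 4 / 2 : ℝ))⁻¹) ^ 2 = (1 + x ^ 2) ^ (-(3 / 4) : ℝ) := by
      rw [← Real.rpow_neg h1.le, ← Real.rpow_natCast, ← Real.rpow_mul h1.le]; norm_num
    have h3 : x ^ (-(3 / 2) : ℝ) = (x ^ 2) ^ (-(3 / 4) : ℝ) := by
      rw [← Real.rpow_natCast, ← Real.rpow_mul hx.le]; norm_num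
    rw [h2, h3, Real.norm_of_nonneg (by positivity)]
    exact Real.rpow_le_rpow_of_nonpos (by positivity) (by linarith) (by norm_num)
  refine ⟨(ell2Norm fun l => ((sobolevWeight L (3 / 4) l : ℝ≥0∞))⁻¹).toNNReal, ?_⟩
  rw [EmbedsInWiener, ENNReal.coe_toNNReal]
  refine (ENNReal.rpow_lt_top_of_nonneg (by norm_num) ?_).ne
  have := ENNReal.tsum_coe_ne_top_iff_summable.2 hs
  convert this using 3 with l
  rw [ENNReal.coe_pow, ENNReal.coe_inv
    (zero_lt_one.trans_le (one_le_sobolevWeight L (by norm_num) l)).ne']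

theorem EmbedsInWiener.mono {K : ℝ≥0} {w₁ w₂ : ℤ → ℝ≥0} (h : EmbedsInWiener K w₁)
    (hw : ∀ l, w₁ l ≤ w₂ l) : EmbedsInWiener K w₂ :=
  (ell2Norm_mono fun l => by gcongr; exact hw l).trans h

theorem sobolevNorm_const_ne_top : ENNReal.ofReal (2 * L) ^ (1 / 2 : ℝ) ≠ ⊤ :=
  (ENNReal.rpow_lt_top_of_nonneg (by norm_num) ENNReal.ofReal_ne_top).ne

variable {L} [hL : Fact (0 < 2 * L)]

theorem sobolevNorm_eq (s : ℝ) {f : Torus L → ℂ} (hf : MemLp f 2 volume) :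
    sobolevNorm s f = ENNReal.ofReal (2 * L) ^ (1 / 2 : ℝ) * weightedNorm (sobolevWeight L s) f := by
  rw [sobolevNorm, if_pos hf, ENNReal.mul_rpow_of_nonneg _ _ (by norm_num), weightedNorm, ell2Norm]
  congr 3
  ext l
  rw [ENNReal.ofReal_mul (by positivity), mul_pow]
  congr 1
  · rw [← ENNReal.ofReal_coe_nnreal, ← ENNReal.ofReal_pow (by positivity)]
    congr 1
    have h1 : 0 ≤ 1 + waveNumber L l ^ 2 := by positivity
    rw [sobolevWeight, NNReal.coe_rpow]
    push_cast [Real.coe_toNNReal _ (sq_nonneg _)]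
    rw [← Real.rpow_mul_natCast h1]
    congr 1
    push_cast; ring
  · rw [ENNReal.ofReal_pow (norm_nonneg _), ofReal_norm]

theorem memLp_of_sobolevNorm_lt_top {s : ℝ} {f : Torus L → ℂ} (h : sobolevNorm s f < ⊤) :
    MemLp f 2 volume := by
  by_contra hf
  rw [sobolevNorm, if_neg hf] at h
  exact lt_irrefl _ h

variable (L) in
theorem sobolevNorm_const_pos : 0 < ENNReal.ofReal (2 * L) ^ (1 / 2 : ℝ) :=
  ENNReal.rpow_pos (by simpa using hL.out) ENNReal.ofReal_ne_top

theorem weightedNorm_lt_top {s : ℝ} {f : Torus L → ℂ} (h : sobolevNorm s f < ⊤) :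
    weightedNorm (sobolevWeight L s) f < ⊤ := by
  rw [sobolevNorm_eq s (memLp_of_sobolevNorm_lt_top h)] at h
  exact ENNReal.lt_top_of_mul_ne_top_right h.ne (sobolevNorm_const_pos L).ne'

end Sobolev

/-! ### Continuous curves in `H¹` and weights dominated by that of `H¹` -/

section Curves

variable {L : ℝ} [hL : Fact (0 < 2 * L)] {T : ℝ} {u v : ℝ → Torus L → ℂ}

/-- Continuous curves `[0, T] → H¹`. -/
structure IsSobolevCurve (T : ℝ) (u : ℝ → Torus L → ℂ) : Prop where
  mem : ∀ t ∈ Icc 0 T, MemSobolev 1 (u t)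
  continuous : ∀ t ∈ Icc 0 T, Tendsto (fun τ => sobolevNorm 1 (u τ - u t)) (𝓝[Icc 0 T] t) (𝓝 0)

theorem IsSobolevCurve.memLp (hu : IsSobolevCurve T u) {t : ℝ} (ht : t ∈ Icc 0 T) :
    MemLp (u t) 2 volume :=
  memLp_of_sobolevNorm_lt_top (hu.mem t ht)

theorem IsSobolevCurve.mono (hu : IsSobolevCurve T u) {T' : ℝ} (h : T' ≤ T) :
    IsSobolevCurve T' u where
  mem t ht := hu.mem t ⟨ht.1, ht.2.trans h⟩
  continuous t ht := (hu.continuous t ⟨ht.1, ht.2.trans h⟩).mono_left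
    (nhdsWithin_mono _ (Icc_subset_Icc_right h))

theorem sobolevNorm_sub_le (s : ℝ) {f g : Torus L → ℂ} (hf : MemLp f 2 volume)
    (hg : MemLp g 2 volume) : sobolevNorm s (f - g) ≤ sobolevNorm s f + sobolevNorm s g := by
  rw [sobolevNorm_eq s hf, sobolevNorm_eq s hg, sobolevNorm_eq s (hf.sub hg), ← mul_add]
  gcongr
  exact weightedNorm_sub_le _ hf hg

theorem IsSobolevCurve.sub (hu : IsSobolevCurve T u) (hv : IsSobolevCurve T v) :
    IsSobolevCurve T (fun t => u t - v t) where
  mem t ht := (sobolevNorm_sub_le 1 (hu.memLp ht) (hv.memLp ht)).trans_lt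
    (ENNReal.add_lt_top.2 ⟨hu.mem t ht, hv.mem t ht⟩)
  continuous t ht := by
    have h := (hu.continuous t ht).add (hv.continuous t ht)
    rw [add_zero] at h
    refine tendsto_of_tendsto_of_tendsto_of_le_of_le' tendsto_const_nhds h
      (Eventually.of_forall fun _ => zero_le) ?_
    filter_upwards [self_mem_nhdsWithin] with τ hτ
    have e : u τ - v τ - (u t - v t) = (u τ - u t) - (v τ - v t) := by abel
    rw [e]
    exact sobolevNorm_sub_le 1 ((hu.memLp hτ).sub (hu.memLp ht)) ((hv.memLp hτ).sub (hv.memLp ht))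

theorem weightedNorm_le_const_mul {C : ℝ≥0} {w w' : ℤ → ℝ≥0} (hw : ∀ l, w l ≤ C * w' l)
    (f : Torus L → ℂ) : weightedNorm w f ≤ C * weightedNorm w' f := by
  rw [weightedNorm, weightedNorm, ← ell2Norm_const_mul]
  refine ell2Norm_mono fun l => ?_
  rw [← mul_assoc]
  gcongr
  exact_mod_cast hw l

variable {C : ℝ≥0} {w : ℤ → ℝ≥0}

theorem IsSobolevCurve.weightedNorm_ne_top (hu : IsSobolevCurve T u)
    (hw : ∀ l, w l ≤ C * sobolevWeight L 1 l) {t : ℝ} (ht : t ∈ Icc 0 T) :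
    weightedNorm w (u t) ≠ ⊤ :=
  ((weightedNorm_le_const_mul hw _).trans_lt
    (ENNReal.mul_lt_top ENNReal.coe_lt_top (weightedNorm_lt_top (hu.mem t ht)))).ne

theorem IsSobolevCurve.tendsto_weightedNorm_sub (hu : IsSobolevCurve T u)
    (hw : ∀ l, w l ≤ C * sobolevWeight L 1 l) {t : ℝ} (ht : t ∈ Icc 0 T) :
    Tendsto (fun τ => weightedNorm w (u τ - u t)) (𝓝[Icc 0 T] t) (𝓝 0) := by
  set κ := ENNReal.ofReal (2 * L) ^ (1 / 2 : ℝ)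
  have hκ : κ ≠ 0 := (sobolevNorm_const_pos L).ne'
  have h : Tendsto (fun τ => C * κ⁻¹ * sobolevNorm 1 (u τ - u t)) (𝓝[Icc 0 T] t) (𝓝 0) := by
    have := ENNReal.Tendsto.const_mul (a := C * κ⁻¹) (hu.continuous t ht)
      (Or.inr (ENNReal.mul_ne_top ENNReal.coe_ne_top (ENNReal.inv_ne_top.2 hκ)))
    rwa [mul_zero] at this
  refine tendsto_of_tendsto_of_tendsto_of_le_of_le' tendsto_const_nhds h
    (Eventually.of_forall fun _ => zero_le) ?_
  filter_upwards [self_mem_nhdsWithin] with τ hτ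
  rw [sobolevNorm_eq 1 ((hu.memLp hτ).sub (hu.memLp ht)), mul_assoc, ← mul_assoc κ⁻¹,
    ENNReal.inv_mul_cancel hκ (sobolevNorm_const_ne_top L), one_mul]
  exact weightedNorm_le_const_mul hw _

theorem IsSobolevCurve.continuousOn_weightedNorm (hu : IsSobolevCurve T u)
    (hw : ∀ l, w l ≤ C * sobolevWeight L 1 l) :
    ContinuousOn (fun t => (weightedNorm w (u t)).toReal) (Icc 0 T) := by
  intro t ht
  have h := (ENNReal.tendsto_toReal ENNReal.zero_ne_top).comp
    (hu.tendsto_weightedNorm_sub hw ht)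
  rw [ContinuousWithinAt, tendsto_iff_dist_tendsto_zero]
  refine tendsto_of_tendsto_of_tendsto_of_le_of_le' tendsto_const_nhds h
    (Eventually.of_forall fun _ => dist_nonneg) ?_
  filter_upwards [self_mem_nhdsWithin] with τ hτ
  have f1 := hu.weightedNorm_ne_top hw hτ
  have f2 := hu.weightedNorm_ne_top hw ht
  have f3 : weightedNorm w (u τ - u t) ≠ ⊤ :=
    ne_top_of_le_ne_top (ENNReal.add_ne_top.2 ⟨f1, f2⟩)
      (weightedNorm_sub_le w (hu.memLp hτ) (hu.memLp ht))
  have h1 := weightedNorm_le_add_sub w (hu.memLp hτ) (hu.memLp ht)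
  have h2 := weightedNorm_le_add_sub w (hu.memLp ht) (hu.memLp hτ)
  rw [weightedNorm_sub_comm w (hu.memLp ht) (hu.memLp hτ)] at h2
  have g1 := ENNReal.toReal_mono (ENNReal.add_ne_top.2 ⟨f2, f3⟩) h1
  have g2 := ENNReal.toReal_mono (ENNReal.add_ne_top.2 ⟨f1, f3⟩) h2
  rw [ENNReal.toReal_add f2 f3] at g1
  rw [ENNReal.toReal_add f1 f3] at g2
  rw [Real.dist_eq, abs_sub_le_iff]
  simp only [Function.comp]
  constructor <;> linarith

theorem IsSobolevCurve.continuousOn_fourierCoeff (hu : IsSobolevCurve T u) (l : ℤ) :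
    ContinuousOn (fun t => fourierCoeff (u t) l) (Icc 0 T) := by
  intro t ht
  have h := hu.tendsto_weightedNorm_sub (w := sobolevWeight L 1) (C := 1) (by simp) ht
  rw [ContinuousWithinAt, tendsto_iff_edist_tendsto_0]
  refine tendsto_of_tendsto_of_tendsto_of_le_of_le' tendsto_const_nhds h
    (Eventually.of_forall fun _ => zero_le) ?_
  filter_upwards [self_mem_nhdsWithin] with τ hτ
  rw [edist_eq_enorm_sub, ← fourierCoeff_sub (hu.memLp hτ) (hu.memLp ht)]
  refine le_trans ?_ (le_ell2Norm _ l)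
  refine le_mul_of_one_le_left zero_le ?_
  exact_mod_cast one_le_sobolevWeight L zero_le_one l

end Curves

/-! ### Gronwall estimates -/

/-- **Gronwall's inequality** in integral form for a continuous function dominated by the
primitive of an affine function of itself. -/
theorem le_of_le_integral_affine {T : ℝ} {Y : ℝ → ℝ} (hY : Continuous Y) (hY0 : ∀ t, 0 ≤ Y t)
    {a b : ℝ} (ha : 0 ≤ a) (hb : 0 < b)
    (h : ∀ t ∈ Icc 0 T, Y t ≤ Y 0 + ∫ τ in (0 : ℝ)..t, (a + b * Y τ)) :
    ∀ t ∈ Icc 0 T, Y t ≤ (Y 0 + a / b) * Real.exp (b * T) := by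
  intro t ht
  have hc : Continuous fun τ => a + b * Y τ := by fun_prop
  set R : ℝ → ℝ := fun t => Y 0 + ∫ τ in (0 : ℝ)..t, (a + b * Y τ) with hR
  have hR' : ∀ t, HasDerivAt R (a + b * Y t) t := fun t =>
    (hc.integral_hasStrictDerivAt 0 t).hasDerivAt.const_add _
  have hcR : Continuous R := continuous_iff_continuousAt.2 fun t => (hR' t).continuousAt
  -- The differential Gronwall inequality is applied to the primitive `R`, since `Y` need not be
  -- differentiable; `Y ≤ R` closes it.
  have hg := norm_le_gronwallBound_of_norm_deriv_right_le (f := R) (f' := fun t => a + b * Y t)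
    (δ := Y 0) (K := b) (ε := a) (a := 0) (b := T) hcR.continuousOn
    (fun x _ => (hR' x).hasDerivWithinAt) (by simp [hR, abs_of_nonneg (hY0 0)])
    (fun x hx => by
      have h1 := h x (Ico_subset_Icc_self hx)
      have h2 := le_abs_self (R x)
      rw [Real.norm_of_nonneg (by have := hY0 x; positivity), Real.norm_eq_abs]
      nlinarith) t ht
  rw [gronwallBound_of_K_ne_0 hb.ne', sub_zero] at hg
  have he : Real.exp (b * t) ≤ Real.exp (b * T) := by
    gcongr; exact ht.2
  have hab : 0 ≤ a / b := by positivity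
  calc Y t ≤ R t := h t ht
    _ ≤ ‖R t‖ := le_abs_self _
    _ ≤ _ := hg
    _ ≤ (Y 0 + a / b) * Real.exp (b * t) := by nlinarith
    _ ≤ _ := by have := hY0 0; gcongr

section Gronwall

variable {L : ℝ} [hL : Fact (0 < 2 * L)] {T : ℝ} {u : ℝ → Torus L → ℂ} {C : ℝ≥0} {w : ℤ → ℝ≥0}

/-- The interaction picture: a unimodular phase cancels the dispersive term, so no power of the
frequency is left in the derivative. -/
theorem hasDerivAt_exp_mul_fourierCoeff {c : ℝ → ℂ} {k n : ℂ} {t : ℝ}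
    (h : HasDerivAt c (-Complex.I * (1 / 2 * k ^ 2 * c t + n)) t) :
    HasDerivAt (fun τ : ℝ => Complex.exp (Complex.I * (1 / 2 * k ^ 2) * τ) * c τ)
      (Complex.exp (Complex.I * (1 / 2 * k ^ 2) * t) * (-Complex.I * n)) t := by
  have h1 : HasDerivAt (fun τ : ℝ => Complex.I * (1 / 2 * k ^ 2) * (τ : ℂ))
      (Complex.I * (1 / 2 * k ^ 2)) t := by
    simpa using (Complex.ofRealCLM.hasDerivAt (x := t)).const_mul (Complex.I * (1 / 2 * k ^ 2))
  exact (h1.cexp.mul h).congr_deriv (by ring)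

theorem norm_exp_phase (k t : ℝ) :
    ‖Complex.exp (Complex.I * (1 / 2 * (k : ℂ) ^ 2) * t)‖ = 1 := by
  have : Complex.I * (1 / 2 * (k : ℂ) ^ 2) * t = ((1 / 2 * k ^ 2 * t : ℝ) : ℂ) * Complex.I := by
    push_cast; ring
  rw [this, Complex.norm_exp_ofReal_mul_I]

theorem ofReal_norm_toLp_sq (F : Finset ℤ) (w : ℤ → ℝ≥0) (e c : ℤ → ℂ) (he : ∀ l, ‖e l‖ = 1) :
    ENNReal.ofReal ‖(WithLp.toLp 2 fun l : F => (w l : ℂ) * (e l * c l) : EuclideanSpace ℂ F)‖ ^ 2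
      = ∑ l ∈ F, (w l * ‖c l‖ₑ) ^ 2 := by
  rw [← ENNReal.ofReal_pow (norm_nonneg _), EuclideanSpace.norm_sq_eq,
    ENNReal.ofReal_sum_of_nonneg (fun _ _ => by positivity), ← Finset.sum_coe_sort F]
  refine Finset.sum_congr rfl fun l _ => ?_
  rw [ENNReal.ofReal_pow (norm_nonneg _)]
  congr 1
  simp [he, ENNReal.ofReal_mul]

theorem ofReal_norm_toLp_le (F : Finset ℤ) (w : ℤ → ℝ≥0) (e c : ℤ → ℂ) (he : ∀ l, ‖e l‖ = 1) :
    ENNReal.ofReal ‖(WithLp.toLp 2 fun l : F => (w l : ℂ) * (e l * c l) : EuclideanSpace ℂ F)‖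
      ≤ ell2Norm fun l => w l * ‖c l‖ₑ := by
  rw [← ENNReal.pow_le_pow_left_iff two_ne_zero, ofReal_norm_toLp_sq F w e c he, ell2Norm_sq]
  exact ENNReal.sum_le_tsum F

/-- Gronwall's inequality for a weighted norm of a curve whose Fourier coefficients solve a
forced Schrödinger equation. -/
theorem IsSobolevCurve.weightedNorm_le_gronwall (hu : IsSobolevCurve T u)
    (hw : ∀ l, w l ≤ C * sobolevWeight L 1 l) {n : ℝ → ℤ → ℂ} {a b : ℝ≥0} (hb : 0 < b)
    (hd : ∀ t ∈ Ioo 0 T, ∀ l, HasDerivAt (fun τ => fourierCoeff (u τ) l)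
      (-Complex.I * ((1 / 2 : ℂ) * (waveNumber L l : ℂ) ^ 2 * fourierCoeff (u t) l + n t l)) t)
    (hn : ∀ t ∈ Ioo 0 T, ell2Norm (fun l => w l * ‖n t l‖ₑ) ≤ a + b * weightedNorm w (u t)) :
    ∀ t ∈ Icc 0 T, weightedNorm w (u t)
      ≤ (weightedNorm w (u 0) + (a / b : ℝ≥0)) * ENNReal.ofReal (Real.exp (b * T)) := by
  rcases lt_or_ge T 0 with hT | hT
  · intro t ht; linarith [ht.1, ht.2]
  have h0 : (0 : ℝ) ∈ Icc 0 T := ⟨le_rfl, hT⟩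
  set Y₀ : ℝ → ℝ := fun t => (weightedNorm w (u t)).toReal with hY₀
  have hY₀c : ContinuousOn Y₀ (Icc 0 T) := hu.continuousOn_weightedNorm hw
  have hY₀e : ∀ t ∈ Icc 0 T, weightedNorm w (u t) = ENNReal.ofReal (Y₀ t) := fun t ht =>
    (ENNReal.ofReal_toReal (hu.weightedNorm_ne_top hw ht)).symm
  -- Extending the norm continuously to the line makes its primitive differentiable everywhere, end
  -- points included.
  set Y : ℝ → ℝ := IccExtend hT ((Icc 0 T).domRestrict Y₀) with hY
  have hYY : ∀ t ∈ Icc 0 T, Y t = Y₀ t := fun t ht => IccExtend_of_mem hT _ ht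
  have hYc : Continuous Y := (continuousOn_iff_continuous_domRestrict.1 hY₀c).Icc_extend'
  have hYnn : ∀ t, 0 ≤ Y t := fun t => ENNReal.toReal_nonneg
  have hc : Continuous fun τ => (a : ℝ) + b * Y τ := by fun_prop
  set R : ℝ → ℝ := fun t => Y 0 + ∫ τ in (0 : ℝ)..t, ((a : ℝ) + b * Y τ) with hR
  have hR' : ∀ t, HasDerivAt R (a + b * Y t) t := fun t =>
    (hc.integral_hasStrictDerivAt 0 t).hasDerivAt.const_add _
  have hcR : Continuous R := continuous_iff_continuousAt.2 fun t => (hR' t).continuousAt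
  have hYR : ∀ t ∈ Icc 0 T, Y t ≤ R t := by
    intro t ht
    rcases ht.1.eq_or_lt with rfl | ht0
    · simp [hR]
    set e : ℝ → ℤ → ℂ := fun τ l =>
      Complex.exp (Complex.I * (1 / 2 * (waveNumber L l : ℂ) ^ 2) * τ) with he
    have he1 : ∀ τ l, ‖e τ l‖ = 1 := fun τ l => norm_exp_phase _ _
    have hRt : 0 ≤ R t := add_nonneg (hYnn 0)
      (intervalIntegral.integral_nonneg ht.1 fun x _ => by have := hYnn x; positivity)
    -- The equation is known only coefficientwise, so the vector-valued derivative bound is used on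
    -- finitely many frequencies, with a bound independent of `F`.
    have key : ∀ F : Finset ℤ, ‖(WithLp.toLp 2 fun l : F => (w l : ℂ) *
        (e t l * fourierCoeff (u t) l) : EuclideanSpace ℂ F)‖ ≤ R t := by
      intro F
      set D : ℝ → EuclideanSpace ℂ F := fun τ => WithLp.toLp 2 fun l : F => (w l : ℂ) *
        (e τ l * fourierCoeff (u τ) l) with hD
      set D' : ℝ → EuclideanSpace ℂ F := fun τ => WithLp.toLp 2 fun l : F => (w l : ℂ) *
        (e τ l * (-Complex.I * n τ l)) with hD'
      have hDY : ∀ τ ∈ Icc 0 T, ‖D τ‖ ≤ Y τ := fun τ hτ => by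
        rw [hYY τ hτ, ← ENNReal.ofReal_le_ofReal_iff ENNReal.toReal_nonneg, ← hY₀e τ hτ]
        exact ofReal_norm_toLp_le F w (e τ) _ (he1 τ)
      have hDd : ∀ τ ∈ Ioo 0 T, HasDerivAt D (D' τ) τ := fun τ hτ => by
        have h : HasDerivAt (fun τ => fun l : F => (w l : ℂ) * (e τ l * fourierCoeff (u τ) l))
            (fun l : F => (w l : ℂ) * (e τ l * (-Complex.I * n τ l))) τ :=
          hasDerivAt_pi.2 fun l =>
            (hasDerivAt_exp_mul_fourierCoeff (hd τ hτ l)).const_mul (w l : ℂ)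
        exact (PiLp.hasFDerivAt_toLp (𝕜 := ℝ) (E := fun _ : F => ℂ) 2 _).comp_hasDerivAt τ h
      have hDc : ContinuousOn D (Icc 0 T) := by
        refine (PiLp.continuous_toLp 2 _).comp_continuousOn (continuousOn_pi.2 fun l => ?_)
        have := hu.continuousOn_fourierCoeff l
        have h2 : Continuous fun τ => e τ l := by rw [he]; fun_prop
        exact continuousOn_const.mul (h2.continuousOn.mul this)
      have hD'b : ∀ τ ∈ Ioo 0 T, ‖D' τ‖ ≤ a + b * Y τ := fun τ hτ => by
        have hτ' := Ioo_subset_Icc_self hτ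
        have hnn := hYnn τ
        rw [← ENNReal.ofReal_le_ofReal_iff (by positivity)]
        refine (ofReal_norm_toLp_le F w (e τ) (fun l => -Complex.I * n τ l) (he1 τ)).trans ?_
        rw [ENNReal.ofReal_add (by positivity) (by positivity), ENNReal.ofReal_mul (by positivity),
          hYY τ hτ', ← hY₀e τ hτ']
        have hI : ‖Complex.I‖ₑ = 1 := by rw [← ofReal_norm, Complex.norm_I, ENNReal.ofReal_one]
        simpa [enorm_mul, hI] using hn τ hτ
      -- The equation holds on the open interval only: start at `ε > 0`, then let `ε → 0` by
      -- continuity.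
      have hε : ∀ ε ∈ Ioo 0 t, ‖D t‖ ≤ Y ε + (R t - R ε) := fun ε hε => by
        have hsub : Ico ε t ⊆ Ioo 0 T := fun x hx => ⟨hε.1.trans_le hx.1, hx.2.trans_le ht.2⟩
        refine image_norm_le_of_norm_deriv_right_le_deriv_boundary (f := D) (f' := D')
          (a := ε) (b := t) (B := fun x => Y ε + (R x - R ε)) (B' := fun x => a + b * Y x)
          (hDc.mono (Icc_subset_Icc hε.1.le ht.2))
          (fun x hx => (hDd x (hsub hx)).hasDerivWithinAt) ?_
          (fun x => ((hR' x).sub_const _).const_add _) (fun x hx => hD'b x (hsub hx))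
          ⟨hε.2.le, le_rfl⟩
        simpa using hDY ε ⟨hε.1.le, hε.2.le.trans ht.2⟩
      have hlim : Tendsto (fun ε => Y ε + (R t - R ε)) (𝓝[>] 0) (𝓝 (Y 0 + (R t - R 0))) :=
        ((hYc.add (continuous_const.sub hcR)).tendsto 0).mono_left nhdsWithin_le_nhds
      have h1 := ge_of_tendsto hlim
        (by filter_upwards [Ioo_mem_nhdsGT ht0] with ε h using hε ε h)
      have h2 : R 0 = Y 0 := by simp [hR]
      linarith
    rw [hYY t ht, ← ENNReal.ofReal_le_ofReal_iff hRt, ← hY₀e t ht]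
    refine ell2Norm_le_of_finset fun F => ?_
    rw [← ofReal_norm_toLp_sq F w (e t) _ (he1 t)]
    gcongr
    exact key F
  intro t ht
  have h := le_of_le_integral_affine hYc hYnn a.2 (NNReal.coe_pos.2 hb) hYR t ht
  rw [hYY t ht, hYY 0 h0] at h
  rw [hY₀e t ht, hY₀e 0 h0, ← ENNReal.ofReal_coe_nnreal, ← ENNReal.ofReal_add
    ENNReal.toReal_nonneg (by positivity), ← ENNReal.ofReal_mul (by positivity)]
  exact ENNReal.ofReal_le_ofReal (by simpa using h)

end Gronwall

/-! ### Algebra estimates for weights embedding into the Wiener algebra -/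

section Algebra

variable {P : ℝ} [hP : Fact (0 < P)] {f g h : AddCircle P → ℂ} {c K : ℝ≥0} {w : ℤ → ℝ≥0}

theorem weightedNorm_add_le (w : ℤ → ℝ≥0) (hf : MemLp f 2 volume) (hg : MemLp g 2 volume) :
    weightedNorm w (f + g) ≤ weightedNorm w f + weightedNorm w g := by
  refine le_trans (ell2Norm_mono fun l => ?_) (ell2Norm_add_le _ _)
  rw [fourierCoeff.add (integrable_of_memLp_two hf) (integrable_of_memLp_two hg), ← mul_add]
  gcongr
  exact enorm_add_le _ _

theorem weightedNorm_const_mul (w : ℤ → ℝ≥0) (a : ℂ) (f : AddCircle P → ℂ) :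
    weightedNorm w (fun x => a * f x) = ‖a‖ₑ * weightedNorm w f := by
  rw [weightedNorm, weightedNorm, ← ell2Norm_const_mul]
  congr 1
  ext l
  rw [fourierCoeff.const_mul, enorm_mul]
  ring

theorem weightedNorm_mul_le_of_embeds (hw : IsAlgebraWeight c w) (hK : EmbedsInWiener K w)
    (hf : MemLp f 2 volume) (hg : MemLp g 2 volume) :
    weightedNorm w (fun x => f x * g x) ≤ 2 * c * K * (weightedNorm w f * weightedNorm w g) := by
  have h1 := wienerNorm_le hK f
  have h2 := wienerNorm_le hK g
  calc _ ≤ _ := weightedNorm_mul_le hw hf hg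
    _ ≤ c * (weightedNorm w f * (K * weightedNorm w g) + K * weightedNorm w f * weightedNorm w g) :=
      by gcongr
    _ = _ := by ring

theorem weightedNorm_mul_mul_le_of_embeds (hw : IsAlgebraWeight c w) (hK : EmbedsInWiener K w)
    (hf : InWiener f) (hg : InWiener g) (hh : InWiener h) :
    weightedNorm w (fun x => f x * g x * h x)
      ≤ 3 * c ^ 2 * K ^ 2 * (weightedNorm w f * weightedNorm w g * weightedNorm w h) := by
  have h1 := wienerNorm_le hK f
  have h2 := wienerNorm_le hK g
  have h3 := wienerNorm_le hK h
  calc _ ≤ _ := weightedNorm_mul_mul_le hw hf hg hh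
    _ ≤ c ^ 2 * (weightedNorm w f * (K * weightedNorm w g) * (K * weightedNorm w h)
        + (K * weightedNorm w f) * weightedNorm w g * (K * weightedNorm w h)
        + (K * weightedNorm w f) * (K * weightedNorm w g) * weightedNorm w h) := by gcongr
    _ = _ := by ring

end Algebra

/-! ### The nonlinear equation: propagation of regularity and stability -/

section NLS

open ComplexConjugate

variable {L : ℝ} [hL : Fact (0 < 2 * L)] {α T : ℝ} {c C K : ℝ≥0} {w : ℤ → ℝ≥0}

omit hL in
theorem nonlinearity_eq (α : ℝ) (W : Torus L → ℝ) (u : Torus L → ℂ) :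
    (fun x => (W x : ℂ) * u x + (α : ℂ) * (‖u x‖ : ℂ) ^ 2 * u x)
      = (fun x => (W x : ℂ) * u x) + fun x => (α : ℂ) * (u x * conj (u x) * u x) := by
  ext x
  rw [Pi.add_apply, Complex.mul_conj, Complex.normSq_eq_norm_sq]
  push_cast
  ring

variable (L) in
theorem exists_embedsInWiener' : ∃ K : ℝ≥0, EmbedsInWiener K (sobolevWeight L (3 / 4)) :=
  exists_embedsInWiener (by have := hL.out; linarith)

theorem inWiener_of_memSobolev {f : Torus L → ℂ} (hf : MemSobolev 1 f) : InWiener f where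
  memLp := memLp_of_sobolevNorm_lt_top hf
  ne_top := by
    obtain ⟨K, hK⟩ := exists_embedsInWiener' L
    have hK := hK.mono (sobolevWeight_mono L (by norm_num : (3 / 4 : ℝ) ≤ 1))
    exact ((wienerNorm_le hK f).trans_lt
      (ENNReal.mul_lt_top ENNReal.coe_lt_top (weightedNorm_lt_top hf))).ne

theorem InWiener.memLp_cubic {f g h : Torus L → ℂ} (hf : InWiener f) (hg : InWiener g)
    (hh : InWiener h) : MemLp (fun x => f x * g x * h x) 2 volume :=
  ((hf.mul hg).mul hh).memLp

theorem InWiener.memLp_nonlinearity {W : Torus L → ℝ} {u : Torus L → ℂ}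
    (hW : InWiener fun x => (W x : ℂ)) (hu : InWiener u) :
    MemLp (fun x => (W x : ℂ) * u x + (α : ℂ) * (‖u x‖ : ℂ) ^ 2 * u x) 2 volume := by
  rw [nonlinearity_eq]
  exact (hW.mul hu).memLp.add ((hu.memLp_cubic hu.conj hu).const_mul _)

/-- Tameness is what matters: the right side is affine in the weighted norm of `u`, the other
factors of `u` entering through the Wiener norm, so Gronwall applies to high norms. -/
theorem weightedNorm_nonlinearity_le (hw : IsAlgebraWeight c w) {W : Torus L → ℝ}
    {u : Torus L → ℂ} (hW : InWiener fun x => (W x : ℂ)) (hu : InWiener u) :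
    weightedNorm w (fun x => (W x : ℂ) * u x + (α : ℂ) * (‖u x‖ : ℂ) ^ 2 * u x)
      ≤ c * (weightedNorm w (fun x => (W x : ℂ)) * wienerNorm u
          + wienerNorm (fun x => (W x : ℂ)) * weightedNorm w u)
        + ‖α‖ₑ * (3 * c ^ 2 * wienerNorm u ^ 2 * weightedNorm w u) := by
  rw [nonlinearity_eq]
  refine (weightedNorm_add_le w (hW.mul hu).memLp
    ((hu.memLp_cubic hu.conj hu).const_mul _)).trans ?_
  refine add_le_add (weightedNorm_mul_le hw hW.memLp hu.memLp) ?_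
  rw [weightedNorm_const_mul]
  have h := weightedNorm_mul_mul_le hw hu hu.conj hu
  rw [weightedNorm_conj hw, wienerNorm_conj] at h
  have : ‖(α : ℂ)‖ₑ = ‖α‖ₑ := by rw [← ofReal_norm, Complex.norm_real, ofReal_norm]
  rw [this]
  gcongr
  exact h.trans_eq (by ring)

variable {W W₁ W₂ : Torus L → ℝ} {u₀ : Torus L → ℂ} {u u₁ u₂ : ℝ → Torus L → ℂ}

theorem IsNLSSolution.isSobolevCurve (hu : IsNLSSolution α T W u₀ u) : IsSobolevCurve T u :=
  ⟨hu.mem, hu.continuous⟩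

theorem IsNLSSolution.mono (hu : IsNLSSolution α T W u₀ u) {T' : ℝ} (h : T' ≤ T) :
    IsNLSSolution α T' W u₀ u where
  mem := (hu.isSobolevCurve.mono h).mem
  continuous := (hu.isSobolevCurve.mono h).continuous
  initial := hu.initial
  equation t ht := hu.equation t ⟨ht.1, ht.2.trans_le h⟩

theorem IsNLSSolution.congr (hu : IsNLSSolution α T W₁ u₀ u) (h : W₁ =ᵐ[volume] W₂) :
    IsNLSSolution α T W₂ u₀ u where
  mem := hu.mem
  continuous := hu.continuous
  initial := hu.initial
  equation t ht l := by
    have h1 := hu.equation t ht l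
    have h2 : (fun x => (W₁ x : ℂ) * u t x + (α : ℂ) * (‖u t x‖ : ℂ) ^ 2 * u t x) =ᵐ[volume]
        fun x => (W₂ x : ℂ) * u t x + (α : ℂ) * (‖u t x‖ : ℂ) ^ 2 * u t x := by
      filter_upwards [h] with x hx
      rw [hx]
    rwa [fourierCoeff_congr_volume h2] at h1

/-- Propagation of a weighted norm along a solution that is bounded in the Wiener algebra. -/
theorem IsNLSSolution.weightedNorm_le (hu : IsNLSSolution α T W u₀ u) (hw : IsAlgebraWeight c w)
    (hwC : ∀ l, w l ≤ C * sobolevWeight L 1 l) (hW : InWiener fun x => (W x : ℂ)) {M B : ℝ≥0}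
    (hWM : weightedNorm w (fun x => (W x : ℂ)) ≤ M) (hWM' : wienerNorm (fun x => (W x : ℂ)) ≤ M)
    (hB : ∀ t ∈ Ioo 0 T, wienerNorm (u t) ≤ B) :
    ∀ t ∈ Icc 0 T, weightedNorm w (u t) ≤
      (weightedNorm w u₀ + (c * M * B / (c * M + ‖α‖₊ * (3 * c ^ 2 * B ^ 2) + 1) : ℝ≥0)) *
        ENNReal.ofReal (Real.exp ((c * M + ‖α‖₊ * (3 * c ^ 2 * B ^ 2) + 1 : ℝ≥0) * T)) := by
  rw [← weightedNorm_congr w hu.initial]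
  refine hu.isSobolevCurve.weightedNorm_le_gronwall hwC (by positivity) hu.equation ?_
  intro t ht
  have h1 := inWiener_of_memSobolev (hu.mem t (Ioo_subset_Icc_self ht))
  have hb := hB t ht
  refine (weightedNorm_nonlinearity_le (α := α) hw hW h1).trans ?_
  calc _ ≤ c * (M * B + M * weightedNorm w (u t))
        + ‖α‖ₑ * (3 * c ^ 2 * (B : ℝ≥0∞) ^ 2 * weightedNorm w (u t)) := by gcongr
    _ = c * M * B + (c * M + ‖α‖ₑ * (3 * c ^ 2 * (B : ℝ≥0∞) ^ 2)) * weightedNorm w (u t) := by ring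
    -- The added `1` keeps the Gronwall rate positive, as it occurs in a denominator.
    _ ≤ c * M * B + (c * M + ‖α‖ₑ * (3 * c ^ 2 * (B : ℝ≥0∞) ^ 2) + 1) * weightedNorm w (u t) := by
      exact add_le_add le_rfl (mul_le_mul_left le_self_add _)
    _ = _ := by rw [enorm_eq_nnnorm]; push_cast; rfl

omit hL in
-- Telescoping: every term carries exactly one difference, `u₁ - u₂` or `W₁ - W₂`, and the latter is
-- multiplied by `u₂` alone.
theorem nonlinearity_sub (α : ℝ) (W₁ W₂ : Torus L → ℝ) (u₁ u₂ : Torus L → ℂ) :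
    (fun x => (W₁ x : ℂ) * u₁ x + (α : ℂ) * (‖u₁ x‖ : ℂ) ^ 2 * u₁ x)
        - (fun x => (W₂ x : ℂ) * u₂ x + (α : ℂ) * (‖u₂ x‖ : ℂ) ^ 2 * u₂ x)
      = ((fun x => (W₁ x : ℂ) * (u₁ - u₂) x) + fun x => ((W₁ - W₂) x : ℂ) * u₂ x)
        + fun x => (α : ℂ) * (((fun x => (u₁ - u₂) x * conj (u₁ x) * u₁ x)
          + (fun x => u₂ x * conj ((u₁ - u₂) x) * u₁ x)
          + fun x => u₂ x * conj (u₂ x) * (u₁ - u₂) x) x) := by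
  rw [nonlinearity_eq, nonlinearity_eq]
  ext x
  simp only [Pi.add_apply, Pi.sub_apply, map_sub]
  push_cast
  ring

/-- The Gronwall rate in the stability estimate. -/
def stabilityRate (α : ℝ) (c K M B : ℝ≥0) : ℝ≥0 :=
  2 * c * K * M + ‖α‖₊ * (9 * c ^ 2 * K ^ 2 * B ^ 2) + 1

/-- The constant in the stability estimate. -/
def stabilityConst (α T : ℝ) (c K M B : ℝ≥0) : ℝ≥0 :=
  2 * c * K * B * (Real.exp (stabilityRate α c K M B * T)).toNNReal

theorem InWiener.real_sub (h₁ : InWiener fun x => (W₁ x : ℂ)) (h₂ : InWiener fun x => (W₂ x : ℂ)) :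
    InWiener fun x => ((W₁ - W₂) x : ℂ) := by
  have := h₁.sub h₂
  convert this using 2 with x
  simp

theorem weightedNorm_nonlinearity_sub_le (hw : IsAlgebraWeight c w) (hK : EmbedsInWiener K w)
    (h₁ : InWiener fun x => (W₁ x : ℂ)) (h₂ : InWiener fun x => (W₂ x : ℂ)) {M B δ : ℝ≥0}
    (hM : weightedNorm w (fun x => (W₁ x : ℂ)) ≤ M)
    (hδ : weightedNorm w (fun x => ((W₁ - W₂) x : ℂ)) ≤ δ) {f₁ f₂ : Torus L → ℂ}
    (hf₁ : InWiener f₁) (hf₂ : InWiener f₂) (hB₁ : weightedNorm w f₁ ≤ B)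
    (hB₂ : weightedNorm w f₂ ≤ B) :
    weightedNorm w ((fun x => (W₁ x : ℂ) * f₁ x + (α : ℂ) * (‖f₁ x‖ : ℂ) ^ 2 * f₁ x)
        - (fun x => (W₂ x : ℂ) * f₂ x + (α : ℂ) * (‖f₂ x‖ : ℂ) ^ 2 * f₂ x))
      ≤ (2 * c * K * B * δ : ℝ≥0) + stabilityRate α c K M B * weightedNorm w (f₁ - f₂) := by
  have hφ := hf₁.sub hf₂
  have hW := h₁.real_sub h₂
  have m1 := hφ.memLp_cubic hf₁.conj hf₁
  have m2 := hf₂.memLp_cubic hφ.conj hf₁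
  have m3 := hf₂.memLp_cubic hf₂.conj hφ
  rw [nonlinearity_sub]
  have hα : ‖(α : ℂ)‖ₑ = ‖α‖ₑ := by rw [← ofReal_norm, Complex.norm_real, ofReal_norm]
  have e1 := weightedNorm_mul_le_of_embeds hw hK h₁.memLp hφ.memLp
  have e2 := weightedNorm_mul_le_of_embeds hw hK hW.memLp hf₂.memLp
  have e3 := weightedNorm_mul_mul_le_of_embeds hw hK hφ hf₁.conj hf₁
  have e4 := weightedNorm_mul_mul_le_of_embeds hw hK hf₂ hφ.conj hf₁
  have e5 := weightedNorm_mul_mul_le_of_embeds hw hK hf₂ hf₂.conj hφ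
  rw [weightedNorm_conj hw] at e3 e4 e5
  set N := weightedNorm w (f₁ - f₂)
  calc _ ≤ _ := weightedNorm_add_le w ((h₁.mul hφ).memLp.add (hW.mul hf₂).memLp)
        (((m1.add m2).add m3).const_mul _)
    -- Three cubic terms with constant `3 * c ^ 2 * K ^ 2` each produce the `9` in `stabilityRate`.
    _ ≤ (2 * c * K * (M * N) + 2 * c * K * (δ * B)) + ‖α‖ₑ *
        ((3 * c ^ 2 * K ^ 2 * (N * B * B) + 3 * c ^ 2 * K ^ 2 * (B * N * B))
          + 3 * c ^ 2 * K ^ 2 * (B * B * N)) := by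
      refine add_le_add ?_ ?_
      · refine (weightedNorm_add_le w (h₁.mul hφ).memLp (hW.mul hf₂).memLp).trans
          (add_le_add (e1.trans ?_) (e2.trans ?_)) <;> gcongr
      · rw [weightedNorm_const_mul, hα]
        gcongr
        refine (weightedNorm_add_le w (m1.add m2) m3).trans (add_le_add
          ((weightedNorm_add_le w m1 m2).trans
            (add_le_add (e3.trans ?_) (e4.trans ?_))) (e5.trans ?_)) <;> gcongr
    _ = 2 * c * K * B * δ + (2 * c * K * M + ‖α‖ₑ * (9 * c ^ 2 * K ^ 2 * B ^ 2)) * N := by ring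
    _ ≤ 2 * c * K * B * δ + (2 * c * K * M + ‖α‖ₑ * (9 * c ^ 2 * K ^ 2 * B ^ 2) + 1) * N := by
      exact add_le_add le_rfl (mul_le_mul_left le_self_add _)
    _ = _ := by rw [enorm_eq_nnnorm, stabilityRate]; push_cast; rfl

/-- Lipschitz dependence of solutions on the potential, in a weighted norm. -/
theorem IsNLSSolution.weightedNorm_sub_le (hu₁ : IsNLSSolution α T W₁ u₀ u₁)
    (hu₂ : IsNLSSolution α T W₂ u₀ u₂) (hw : IsAlgebraWeight c w) (hK : EmbedsInWiener K w)
    (hwC : ∀ l, w l ≤ C * sobolevWeight L 1 l)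
    (h₁ : InWiener fun x => (W₁ x : ℂ)) (h₂ : InWiener fun x => (W₂ x : ℂ)) {M B δ : ℝ≥0}
    (hM : weightedNorm w (fun x => (W₁ x : ℂ)) ≤ M)
    (hδ : weightedNorm w (fun x => ((W₁ - W₂) x : ℂ)) ≤ δ)
    (hB₁ : ∀ t ∈ Ioo 0 T, weightedNorm w (u₁ t) ≤ B)
    (hB₂ : ∀ t ∈ Ioo 0 T, weightedNorm w (u₂ t) ≤ B) :
    ∀ t ∈ Icc 0 T, weightedNorm w (u₁ t - u₂ t) ≤ stabilityConst α T c K M B * δ := by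
  have hc₁ := hu₁.isSobolevCurve
  have hc₂ := hu₂.isSobolevCurve
  have hin : ∀ t ∈ Ioo 0 T, InWiener (u₁ t) ∧ InWiener (u₂ t) := fun t ht =>
    ⟨inWiener_of_memSobolev (hu₁.mem t (Ioo_subset_Icc_self ht)),
      inWiener_of_memSobolev (hu₂.mem t (Ioo_subset_Icc_self ht))⟩
  have hone : 1 ≤ stabilityRate α c K M B := le_add_self
  intro t ht
  have h := (hc₁.sub hc₂).weightedNorm_le_gronwall hwC (a := 2 * c * K * B * δ)
    (n := fun t l => fourierCoeff
        ((fun x => (W₁ x : ℂ) * u₁ t x + (α : ℂ) * (‖u₁ t x‖ : ℂ) ^ 2 * u₁ t x)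
        - (fun x => (W₂ x : ℂ) * u₂ t x + (α : ℂ) * (‖u₂ t x‖ : ℂ) ^ 2 * u₂ t x)) l)
    (b := stabilityRate α c K M B) (zero_lt_one.trans_le hone)
    (fun t ht l => by
      have hmem : ∀ᶠ τ in 𝓝 t, τ ∈ Ioo 0 T := Ioo_mem_nhds ht.1 ht.2
      have he : (fun τ => fourierCoeff (u₁ τ - u₂ τ) l) =ᶠ[𝓝 t]
          fun τ => fourierCoeff (u₁ τ) l - fourierCoeff (u₂ τ) l := by
        filter_upwards [hmem] with τ hτ
        exact fourierCoeff_sub (hin τ hτ).1.memLp (hin τ hτ).2.memLp l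
      refine HasDerivAt.congr_of_eventuallyEq ?_ he
      refine ((hu₁.equation t ht l).sub (hu₂.equation t ht l)).congr_deriv ?_
      rw [fourierCoeff_sub (hin t ht).1.memLp (hin t ht).2.memLp,
        fourierCoeff_sub (h₁.memLp_nonlinearity (hin t ht).1)
          (h₂.memLp_nonlinearity (hin t ht).2)]
      ring)
    (fun t ht => weightedNorm_nonlinearity_sub_le hw hK h₁ h₂ hM hδ (hin t ht).1 (hin t ht).2
      (hB₁ t ht) (hB₂ t ht)) t ht
  have h0 : weightedNorm w (u₁ 0 - u₂ 0) = 0 := by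
    have : (u₁ 0 - u₂ 0) =ᵐ[volume] (0 : Torus L → ℂ) := by
      filter_upwards [hu₁.initial, hu₂.initial] with x hx hy
      simp [hx, hy]
    rw [weightedNorm_congr w this]
    simp [weightedNorm, ell2Norm, fourierCoeff]
  rw [h0, zero_add] at h
  refine h.trans ?_
  calc _ ≤ ((2 * c * K * B * δ : ℝ≥0) : ℝ≥0∞) *
        ENNReal.ofReal (Real.exp (stabilityRate α c K M B * T)) := by
        gcongr
        -- The rate is at least `1`, so dividing the forcing by it only helps.
        exact div_le_self zero_le hone
    _ = _ := by rw [stabilityConst, ENNReal.ofReal]; push_cast; ring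

end NLS

/-! ### The parameter box and continuity of the potential's Fourier coefficients -/

theorem isCompact_paramBox : IsCompact paramBox := by
  have : paramBox = Set.pi univ fun _ : ℕ => Icc (-(1 / 2) : ℝ) (1 / 2) := by
    ext ξ
    exact ⟨fun h j _ => h j, fun h j => h j (mem_univ j)⟩
  rw [this]
  exact isCompact_univ_pi fun _ => isCompact_Icc

/-- A series that converges for all choices of parameters in the box converges absolutely. -/
theorem summable_abs_of_tendsto_paramBox {a : ℕ → ℝ}
    (h : ∀ ξ ∈ paramBox, ∃ s, Tendsto (fun m => ∑ j ∈ Finset.range m, ξ j * a j) atTop (𝓝 s)) :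
    Summable fun j => |a j| := by
  -- The vertex of the box with the signs of `a` turns the series into half the sum of `|a j|`.
  obtain ⟨s, hs⟩ := h (fun j => if 0 ≤ a j then 1 / 2 else -(1 / 2)) fun j => by
    dsimp only; split_ifs <;> constructor <;> norm_num
  have e : ∀ j, (if 0 ≤ a j then 1 / 2 else -(1 / 2)) * a j = 1 / 2 * |a j| := fun j => by
    split_ifs with hj
    · rw [abs_of_nonneg hj]
    · rw [abs_of_neg (not_le.1 hj)]; ring
  simp_rw [e] at hs
  have := ((hasSum_iff_tendsto_nat_of_nonneg (fun j => by positivity) s).2 hs).summable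
  simpa using this.mul_left 2

section Potential

variable {L : ℝ} [hL : Fact (0 < 2 * L)] {lam : ℕ → ℝ} {v₀ : Torus L → ℝ} {v : ℕ → Torus L → ℝ}
  {V : (ℕ → ℝ) → Torus L → ℝ}

theorem memLp_complex_ofReal {f : Torus L → ℝ} (hf : MemLp f 2 volume) :
    MemLp (fun x => (f x : ℂ)) 2 volume :=
  hf.ofReal

theorem enorm_fourierCoeff_mul_le_eLpNorm {f : Torus L → ℂ} (hf : MemLp f 2 volume) (l : ℤ) :
    ‖fourierCoeff f l‖ₑ * ENNReal.ofReal (2 * L) ^ (1 / 2 : ℝ) ≤ eLpNorm f 2 volume := by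
  have h0 : ENNReal.ofReal (2 * L) ≠ 0 := by simpa using hL.out
  have h1 : ‖fourierCoeff f l‖ₑ ≤ eLpNorm f 1 AddCircle.haarAddCircle := by
    rw [eLpNorm_one_eq_lintegral_enorm]
    refine (enorm_integral_le_lintegral_enorm _).trans_eq (lintegral_congr fun x => ?_)
    rw [enorm_smul, ← ofReal_norm (fourier (-l) x), fourier_apply, Circle.norm_coe]
    simp
  have h2 : eLpNorm f 2 volume
      = ENNReal.ofReal (2 * L) ^ (1 / 2 : ℝ) * eLpNorm f 2 AddCircle.haarAddCircle := by
    rw [AddCircle.volume_eq_smul_haarAddCircle, eLpNorm_smul_measure_of_ne_zero h0]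
    simp
  rw [h2, mul_comm]
  gcongr
  exact h1.trans (eLpNorm_le_eLpNorm_of_exponent_le (by norm_num) hf.haarAddCircle.1)

theorem IsKLPotential.memLp_trunc (h : IsKLPotential lam v₀ v V) (m : ℕ) (ξ : Fin m → ℝ) :
    MemLp (truncPotential lam v₀ v m ξ) 2 volume := by
  have : truncPotential lam v₀ v m ξ
      = v₀ + fun x => ∑ j : Fin m, Real.sqrt (lam j) * ξ j * v j x := rfl
  rw [this]
  exact h.memLp_zero.add (memLp_finsetSum _ fun j _ => (h.memLp j).const_mul _)

theorem IsKLPotential.fourierCoeff_trunc (h : IsKLPotential lam v₀ v V) (m : ℕ) (ξ : ℕ → ℝ)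
    (l : ℤ) :
    fourierCoeff (fun x => (truncPotential lam v₀ v m (firstCoords m ξ) x : ℂ)) l
      = fourierCoeff (fun x => (v₀ x : ℂ)) l + ∑ j ∈ Finset.range m,
        (ξ j : ℂ) * ((Real.sqrt (lam j) : ℂ) * fourierCoeff (fun x => (v j x : ℂ)) l) := by
  have hv : ∀ j, MemLp (fun x => (ξ j : ℂ) * ((Real.sqrt (lam j) : ℂ) * (v j x : ℂ))) 2 volume :=
    fun j => ((memLp_complex_ofReal (h.memLp j)).const_mul _).const_mul _
  have e : (fun x => (truncPotential lam v₀ v m (firstCoords m ξ) x : ℂ))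
      = (fun x => (v₀ x : ℂ)) + ∑ j ∈ Finset.range m,
        fun x => (ξ j : ℂ) * ((Real.sqrt (lam j) : ℂ) * (v j x : ℂ)) := by
    ext x
    simp only [truncPotential, firstCoords, Pi.add_apply, Finset.sum_apply, Finset.sum_range]
    push_cast
    congr 1
    exact Finset.sum_congr rfl fun j _ => by ring
  rw [e, fourierCoeff.add (integrable_of_memLp_two (memLp_complex_ofReal h.memLp_zero))
      (integrable_of_memLp_two (memLp_finsetSum' _ fun j _ => hv j)),
    fourierCoeff.sum _ _ fun j _ => integrable_of_memLp_two (hv j), Pi.add_apply,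
    Finset.sum_apply]
  simp_rw [fourierCoeff.const_mul]

theorem IsKLPotential.tendsto_fourierCoeff (h : IsKLPotential lam v₀ v V) {ξ : ℕ → ℝ}
    (hξ : ξ ∈ paramBox) (hV : MemLp (fun x => (V ξ x : ℂ)) 2 volume) (l : ℤ) :
    Tendsto (fun m => ∑ j ∈ Finset.range m,
        (ξ j : ℂ) * ((Real.sqrt (lam j) : ℂ) * fourierCoeff (fun x => (v j x : ℂ)) l)) atTop
      (𝓝 (fourierCoeff (fun x => (V ξ x : ℂ)) l - fourierCoeff (fun x => (v₀ x : ℂ)) l)) := by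
  set κ := ENNReal.ofReal (2 * L) ^ (1 / 2 : ℝ)
  have hκ : κ ≠ 0 := (sobolevNorm_const_pos L).ne'
  have h1 := ENNReal.Tendsto.mul_const (b := κ⁻¹) (h.tendsto ξ hξ)
    (Or.inr (ENNReal.inv_ne_top.2 hκ))
  rw [zero_mul] at h1
  rw [tendsto_iff_edist_tendsto_0]
  refine tendsto_of_tendsto_of_tendsto_of_le_of_le tendsto_const_nhds h1 (fun _ => zero_le) ?_
  intro m
  have hm := memLp_complex_ofReal (h.memLp_trunc m (firstCoords m ξ))
  have h2 := enorm_fourierCoeff_mul_le_eLpNorm (hm.sub hV) l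
  have h3 : eLpNorm (truncPotential lam v₀ v m (firstCoords m ξ) - V ξ) 2 volume =
      eLpNorm ((fun x => (truncPotential lam v₀ v m (firstCoords m ξ) x : ℂ))
        - fun x => (V ξ x : ℂ)) 2 volume := by
    refine eLpNorm_congr_norm_ae (ae_of_all _ fun x => ?_)
    rw [Pi.sub_apply, Pi.sub_apply, ← Complex.ofReal_sub, Complex.norm_real]
  have h4 := fourierCoeff_sub hm hV l
  rw [h4, h.fourierCoeff_trunc] at h2
  dsimp only
  rw [h3, ← div_eq_mul_inv, ENNReal.le_div_iff_mul_le (Or.inl hκ)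
    (Or.inl (sobolevNorm_const_ne_top L)), edist_eq_enorm_sub]
  rwa [show ∀ a b d : ℂ, a - (b - d) = d + a - b from fun _ _ _ => by ring]

/-- The coefficient series converges at every point of the box, hence absolutely (real and imaginary
parts separately); the Weierstrass test then gives continuity in the product topology. -/
theorem IsKLPotential.continuousOn_fourierCoeff (h : IsKLPotential lam v₀ v V)
    (hV : ∀ ξ ∈ paramBox, MemLp (fun x => (V ξ x : ℂ)) 2 volume) (l : ℤ) :
    ContinuousOn (fun ξ => fourierCoeff (fun x => (V ξ x : ℂ)) l) paramBox := by
  set a : ℕ → ℂ := fun j => (Real.sqrt (lam j) : ℂ) * fourierCoeff (fun x => (v j x : ℂ)) l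
  have ht : ∀ ξ ∈ paramBox, Tendsto (fun m => ∑ j ∈ Finset.range m, (ξ j : ℂ) * a j) atTop
      (𝓝 (fourierCoeff (fun x => (V ξ x : ℂ)) l - fourierCoeff (fun x => (v₀ x : ℂ)) l)) :=
    fun ξ hξ => h.tendsto_fourierCoeff hξ (hV ξ hξ) l
  clear_value a
  have hre : Summable fun j => |(a j).re| := summable_abs_of_tendsto_paramBox fun ξ hξ =>
    ⟨_, by simpa [Function.comp_def] using (Complex.continuous_re.tendsto _).comp (ht ξ hξ)⟩
  have him : Summable fun j => |(a j).im| := summable_abs_of_tendsto_paramBox fun ξ hξ =>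
    ⟨_, by simpa [Function.comp_def] using (Complex.continuous_im.tendsto _).comp (ht ξ hξ)⟩
  have ha : Summable fun j => ‖a j‖ := Summable.of_nonneg_of_le (fun _ => norm_nonneg _)
    (fun j => Complex.norm_le_abs_re_add_abs_im _) (hre.add him)
  have hb : ∀ j, ∀ ξ ∈ paramBox, ‖(ξ j : ℂ) * a j‖ ≤ ‖a j‖ := fun j ξ hξ => by
    rw [norm_mul, Complex.norm_real, Real.norm_eq_abs]
    refine mul_le_of_le_one_left (norm_nonneg _) (abs_le.2 ?_)
    constructor <;> linarith [(hξ j).1, (hξ j).2]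
  have hc : ContinuousOn (fun ξ : ℕ → ℝ => fourierCoeff (fun x => (v₀ x : ℂ)) l
      + ∑' j, (ξ j : ℂ) * a j) paramBox :=
    continuousOn_const.add (continuousOn_tsum (fun j => by fun_prop) ha hb)
  refine hc.congr fun ξ hξ => ?_
  have hs : Summable fun j => (ξ j : ℂ) * a j :=
    .of_norm_bounded ha fun j => hb j ξ hξ
  dsimp only
  rw [tendsto_nhds_unique hs.hasSum.tendsto_sum_nat (ht ξ hξ)]
  ring

end Potential

/-! ### From coefficientwise to `H^{3/4}` convergence -/

section Interpolation

variable {L : ℝ} [hL : Fact (0 < 2 * L)]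

/-- The ratio of the two weights is `(1 + (π l / L)²)^{-1/8}`; it tends to zero because the inverse
squared weights are summable. -/
theorem eventually_sobolevWeight_le {η : ℝ≥0} (hη : 0 < η) :
    ∀ᶠ l in cofinite, sobolevWeight L (3 / 4) l ≤ η * sobolevWeight L 1 l := by
  obtain ⟨K, hK⟩ := exists_embedsInWiener' L
  have hs : ∑' l, ((sobolevWeight L (3 / 4) l : ℝ≥0∞))⁻¹ ^ 2 ≠ ⊤ := by
    rw [← ell2Norm_sq]
    exact ENNReal.pow_ne_top (ne_top_of_le_ne_top ENNReal.coe_ne_top hK)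
  have h1 := ENNReal.tendsto_cofinite_zero_of_tsum_ne_top hs
  have h2 : (0 : ℝ≥0∞) < ((η ^ 3 : ℝ≥0) : ℝ≥0∞) ^ 2 :=
    ENNReal.pow_pos (by exact_mod_cast pow_pos hη 3) 2
  filter_upwards [h1.eventually_lt_const h2] with l hl
  have h3 := (ENNReal.pow_lt_pow_left_iff two_ne_zero).1 hl
  set y : ℝ≥0 := (1 + (waveNumber L l ^ 2).toNNReal) ^ (1 / 8 : ℝ)
  have e1 : sobolevWeight L (3 / 4) l = y ^ 3 := by
    rw [sobolevWeight, ← NNReal.rpow_mul_natCast]; norm_num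
  have e2 : sobolevWeight L 1 l = y ^ 4 := by
    rw [sobolevWeight, ← NNReal.rpow_mul_natCast]; norm_num
  have hy : 1 ≤ y := NNReal.one_le_rpow le_self_add (by norm_num)
  have hy0 : 0 < y := zero_lt_one.trans_le hy
  rw [e1, ← ENNReal.coe_inv (by positivity), ENNReal.coe_lt_coe, ← inv_pow,
    pow_lt_pow_iff_left₀ zero_le zero_le three_ne_zero, inv_lt_iff_one_lt_mul₀ hy0] at h3
  rw [e1, e2]
  calc y ^ 3 = 1 * y ^ 3 := (one_mul _).symm
    _ ≤ (η * y) * y ^ 3 := by gcongr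
    _ = _ := by ring

/-- Convergence of the Fourier coefficients and boundedness in `H¹` imply convergence in
`H^{3/4}`. -/
theorem eventually_weightedNorm_le {X : Type*} {F : Filter X} {f : X → Torus L → ℂ} {M δ : ℝ≥0}
    (hδ : 0 < δ) (hf : ∀ l, Tendsto (fun ξ => fourierCoeff (f ξ) l) F (𝓝 0))
    (hM : ∀ᶠ ξ in F, weightedNorm (sobolevWeight L 1) (f ξ) ≤ M) :
    ∀ᶠ ξ in F, weightedNorm (sobolevWeight L (3 / 4)) (f ξ) ≤ δ := by
  classical
  -- Chosen so that `η + η * M = δ`: the finitely many low frequencies cost `η`, the tail `η * M`.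
  set η : ℝ≥0 := δ / (M + 1) with hη
  have hη0 : 0 < η := by positivity
  have hfin := eventually_sobolevWeight_le (L := L) hη0
  rw [eventually_cofinite] at hfin
  set S := hfin.toFinset
  have h1 : Tendsto (fun ξ => ell2Norm fun l => if l ∈ S then
      (sobolevWeight L (3 / 4) l : ℝ≥0∞) * ‖fourierCoeff (f ξ) l‖ₑ else 0) F (𝓝 0) := by
    have e : ∀ ξ, (ell2Norm fun l => if l ∈ S then
        (sobolevWeight L (3 / 4) l : ℝ≥0∞) * ‖fourierCoeff (f ξ) l‖ₑ else 0)
        = (∑ l ∈ S, ((sobolevWeight L (3 / 4) l : ℝ≥0∞) * ‖fourierCoeff (f ξ) l‖ₑ) ^ 2)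
          ^ (1 / 2 : ℝ) := fun ξ => by
      rw [ell2Norm, tsum_eq_sum (s := S) fun l hl => by simp [hl]]
      congr 1
      exact Finset.sum_congr rfl fun l hl => by simp [hl]
    simp_rw [e]
    have h2 : Tendsto (fun ξ => ∑ l ∈ S, ((sobolevWeight L (3 / 4) l : ℝ≥0∞)
        * ‖fourierCoeff (f ξ) l‖ₑ) ^ 2) F (𝓝 (∑ l ∈ S, 0)) := by
      refine tendsto_finsetSum _ fun l _ => ?_
      have h3 : Tendsto (fun ξ => ‖fourierCoeff (f ξ) l‖ₑ) F (𝓝 0) := by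
        simpa using (hf l).enorm
      have h4 := ENNReal.Tendsto.const_mul (a := (sobolevWeight L (3 / 4) l : ℝ≥0∞)) h3
        (Or.inr ENNReal.coe_ne_top)
      simpa [Function.comp_def] using ((ENNReal.continuous_pow 2).tendsto _).comp h4
    rw [Finset.sum_const_zero] at h2
    simpa [Function.comp_def] using ((ENNReal.continuous_rpow_const (y := 1 / 2)).tendsto _).comp h2
  filter_upwards [hM, (ENNReal.tendsto_nhds_zero.1 h1) η (by exact_mod_cast hη0)] with ξ hξ hS
  have h2 : ∀ l, (sobolevWeight L (3 / 4) l : ℝ≥0∞) * ‖fourierCoeff (f ξ) l‖ₑ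
      ≤ (if l ∈ S then (sobolevWeight L (3 / 4) l : ℝ≥0∞) * ‖fourierCoeff (f ξ) l‖ₑ else 0)
        + η * (sobolevWeight L 1 l * ‖fourierCoeff (f ξ) l‖ₑ) := fun l => by
    by_cases hl : l ∈ S
    · simp [hl]
    · have h3 : sobolevWeight L (3 / 4) l ≤ η * sobolevWeight L 1 l := by
        simpa [S] using hl
      rw [if_neg hl, zero_add, ← mul_assoc]
      gcongr
      exact_mod_cast h3
  calc _ ≤ _ := ell2Norm_mono h2
    _ ≤ _ := ell2Norm_add_le _ _
    _ ≤ η + η * M := by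
      rw [ell2Norm_const_mul]
      gcongr
      exact hξ
    _ = δ := by
      have : η + η * M = δ := by rw [hη]; field_simp; ring
      exact_mod_cast this

end Interpolation

/-! ### Bounds uniform in the parameter -/

section UniformBounds

variable {L : ℝ} [hL : Fact (0 < 2 * L)] {α T : ℝ} {c C K : ℝ≥0} {w : ℤ → ℝ≥0}
variable {W₁ W₂ : Torus L → ℝ} {u₀ : Torus L → ℂ} {u u₁ u₂ : ℝ → Torus L → ℂ}

theorem IsSobolevCurve.exists_weightedNorm_le (hu : IsSobolevCurve T u)
    (hw : ∀ l, w l ≤ C * sobolevWeight L 1 l) :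
    ∃ B : ℝ≥0, ∀ t ∈ Icc 0 T, weightedNorm w (u t) ≤ B := by
  obtain ⟨B, hB⟩ := isCompact_Icc.exists_bound_of_continuousOn (hu.continuousOn_weightedNorm hw)
  refine ⟨B.toNNReal, fun t ht => ?_⟩
  rw [← ENNReal.ofReal_toReal (hu.weightedNorm_ne_top hw ht)]
  exact ENNReal.ofReal_le_ofReal ((le_abs_self _).trans (hB t ht))

omit hL in
theorem stabilityConst_mono {T T' : ℝ} (h : T ≤ T') (M B : ℝ≥0) :
    stabilityConst α T c K M B ≤ stabilityConst α T' c K M B := by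
  rw [stabilityConst, stabilityConst]
  gcongr

/-- Solutions with nearby potentials obey nearby bounds. -/
theorem IsNLSSolution.weightedNorm_le_add_one (hu₁ : IsNLSSolution α T W₁ u₀ u₁)
    (hu₂ : IsNLSSolution α T W₂ u₀ u₂) (hw : IsAlgebraWeight c w) (hK : EmbedsInWiener K w)
    (hwC : ∀ l, w l ≤ C * sobolevWeight L 1 l)
    (h₁ : InWiener fun x => (W₁ x : ℂ)) (h₂ : InWiener fun x => (W₂ x : ℂ)) {M B δ : ℝ≥0}
    (hM : weightedNorm w (fun x => (W₁ x : ℂ)) ≤ M)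
    (hδ : weightedNorm w (fun x => ((W₁ - W₂) x : ℂ)) ≤ δ)
    (hB : ∀ t ∈ Icc 0 T, weightedNorm w (u₁ t) ≤ B)
    (hS : stabilityConst α T c K M (B + 1) * δ < 1) :
    ∀ t ∈ Icc 0 T, weightedNorm w (u₂ t) ≤ (B + 1 : ℝ≥0) := by
  have hc₁ := hu₁.isSobolevCurve
  have hc₂ := hu₂.isSobolevCurve
  have hc := hc₁.sub hc₂
  have step : ∀ t ∈ Icc 0 T, weightedNorm w (u₁ t - u₂ t) ≤ 1 →
      weightedNorm w (u₂ t) ≤ (B + 1 : ℝ≥0) := fun t ht h => by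
    refine (weightedNorm_le_add_sub w (hc₂.memLp ht) (hc₁.memLp ht)).trans ?_
    rw [weightedNorm_sub_comm w (hc₂.memLp ht) (hc₁.memLp ht)]
    push_cast
    exact add_le_add (hB t ht) h
  have hcont := hc.continuousOn_weightedNorm hwC
  -- Bootstrap: before the first time at which the difference reaches `1`, `u₂` is bounded by `B +
  -- 1`, so stability gives a difference strictly below `1` at that very time.
  have key : ∀ t ∈ Icc 0 T, (weightedNorm w (u₁ t - u₂ t)).toReal < 1 := by
    by_contra! hne
    have hcl : IsCompact {t ∈ Icc 0 T | 1 ≤ (weightedNorm w (u₁ t - u₂ t)).toReal} :=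
      isCompact_Icc.of_isClosed_subset
        (hcont.preimage_isClosed_of_isClosed isClosed_Icc isClosed_Ici) fun t ht => ht.1
    obtain ⟨t₁, ⟨ht₁, h1⟩, hleast⟩ := hcl.exists_isLeast hne
    have hlt : ∀ t ∈ Ioo 0 t₁, weightedNorm w (u₁ t - u₂ t) ≤ 1 := fun t ht => by
      have htT : t ∈ Icc 0 T := ⟨ht.1.le, ht.2.le.trans ht₁.2⟩
      by_contra hcon
      have h2 := hleast ⟨htT, by
        have := ENNReal.toReal_mono (hc.weightedNorm_ne_top hwC htT) (not_le.1 hcon).le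
        simpa using this⟩
      exact absurd ht.2 (not_lt.2 h2)
    have hst := (hu₁.mono ht₁.2).weightedNorm_sub_le (hu₂.mono ht₁.2) hw hK hwC h₁ h₂ hM hδ
      (B := B + 1)
      (fun t ht => (hB t ⟨ht.1.le, ht.2.le.trans ht₁.2⟩).trans (by simp))
      (fun t ht => step t ⟨ht.1.le, ht.2.le.trans ht₁.2⟩ (hlt t ht)) t₁ ⟨ht₁.1, le_rfl⟩
    have h2 : stabilityConst α t₁ c K M (B + 1) * δ < 1 :=
      (mul_le_mul_left (stabilityConst_mono ht₁.2 _ _) _).trans_lt hS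
    have h3 : weightedNorm w (u₁ t₁ - u₂ t₁) < 1 := hst.trans_lt (by exact_mod_cast h2)
    have h4 := (ENNReal.toReal_lt_toReal h3.ne_top ENNReal.one_ne_top).2 h3
    rw [ENNReal.toReal_one] at h4
    linarith
  intro t ht
  refine step t ht ?_
  rw [← ENNReal.ofReal_toReal (hc.weightedNorm_ne_top hwC ht)]
  exact ENNReal.ofReal_le_one.2 (key t ht).le

/-- On a finite set of frequencies the cap has no effect once `N` exceeds the weights there. -/
theorem weightedNorm_le_of_forall_min {f : Torus L → ℂ} {X : ℝ≥0∞}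
    (h : ∀ N : ℝ≥0, weightedNorm (fun l => min (w l) N) f ≤ X) : weightedNorm w f ≤ X := by
  refine ell2Norm_le_of_finset fun F => ?_
  calc _ = ∑ l ∈ F, (((min (w l) (F.sup w) : ℝ≥0) : ℝ≥0∞) * ‖fourierCoeff f l‖ₑ) ^ 2 :=
        Finset.sum_congr rfl fun l hl => by rw [min_eq_left (Finset.le_sup hl)]
    _ ≤ ∑' l, (((min (w l) (F.sup w) : ℝ≥0) : ℝ≥0∞) * ‖fourierCoeff f l‖ₑ) ^ 2 :=
        ENNReal.sum_le_tsum F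
    _ = weightedNorm (fun l => min (w l) (F.sup w)) f ^ 2 := (ell2Norm_sq _).symm
    _ ≤ _ := by gcongr; exact h _

variable {lam : ℕ → ℝ} {v₀ : Torus L → ℝ} {v : ℕ → Torus L → ℝ} {V : (ℕ → ℝ) → Torus L → ℝ}
  {ψin : Torus L → ℂ} {ψ : ℝ → (ℕ → ℝ) → Torus L → ℂ}

/-- Solutions are bounded in `H^{3/4}` uniformly in the parameter. -/
theorem IsKLPotential.exists_uniform_bound (h : IsKLPotential lam v₀ v V) {M : ℝ≥0}
    (hV : ∀ ξ ∈ paramBox, MemSobolev 1 fun x => (V ξ x : ℂ))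
    (hM : ∀ ξ ∈ paramBox, weightedNorm (sobolevWeight L 1) (fun x => (V ξ x : ℂ)) ≤ M)
    (hψ : ∀ ξ ∈ paramBox, IsNLSSolution α T (V ξ) ψin (fun t => ψ t ξ)) :
    ∃ B : ℝ≥0, ∀ ξ ∈ paramBox, ∀ t ∈ Icc 0 T,
      weightedNorm (sobolevWeight L (3 / 4)) (ψ t ξ) ≤ B := by
  obtain ⟨K, hK⟩ := exists_embedsInWiener' L
  have hw := sobolevWeight_isAlgebraWeight L (by norm_num : (0 : ℝ) ≤ 3 / 4)
  have hle := sobolevWeight_mono L (by norm_num : (3 / 4 : ℝ) ≤ 1)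
  have hwC : ∀ l, sobolevWeight L (3 / 4) l ≤ 1 * sobolevWeight L 1 l := by simpa using hle
  have hin : ∀ ξ ∈ paramBox, InWiener fun x => (V ξ x : ℂ) := fun ξ hξ =>
    inWiener_of_memSobolev (hV ξ hξ)
  -- Having a common bound passes to subsets and finite unions, so a bound near each parameter
  -- suffices.
  refine isCompact_paramBox.induction_on
    (p := fun S => ∃ B : ℝ≥0, ∀ ξ ∈ S, ∀ t ∈ Icc 0 T,
      weightedNorm (sobolevWeight L (3 / 4)) (ψ t ξ) ≤ B) ⟨0, by simp⟩
    (fun S S' hSS' ⟨B, hB⟩ => ⟨B, fun ξ hξ => hB ξ (hSS' hξ)⟩) ?_ ?_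
  · rintro S S' ⟨B, hB⟩ ⟨B', hB'⟩
    refine ⟨max B B', fun ξ hξ t ht => ?_⟩
    rcases hξ with hξ | hξ
    · exact (hB ξ hξ t ht).trans (by simp)
    · exact (hB' ξ hξ t ht).trans (by simp)
  · intro ξ₀ hξ₀
    obtain ⟨B, hB⟩ := (hψ ξ₀ hξ₀).isSobolevCurve.exists_weightedNorm_le hwC
    set S := stabilityConst α T (4 ^ (3 / 4 / 2 : ℝ)) K M (B + 1)
    have hδ : 0 < 1 / (S + 1) := by positivity
    have hSδ : S * (1 / (S + 1)) < 1 := by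
      rw [mul_one_div, div_lt_one (by positivity)]
      exact lt_add_one S
    have hev : ∀ᶠ ξ in 𝓝[paramBox] ξ₀, weightedNorm (sobolevWeight L (3 / 4))
        (fun x => ((V ξ₀ - V ξ) x : ℂ)) ≤ (1 / (S + 1) : ℝ≥0) := by
      have e : ∀ ξ, (fun x => ((V ξ₀ - V ξ) x : ℂ))
          = (fun x => (V ξ₀ x : ℂ)) - fun x => (V ξ x : ℂ) := fun ξ => by ext x; simp
      refine eventually_weightedNorm_le (M := M + M) hδ (fun l => ?_) ?_
      · have h1 := (h.continuousOn_fourierCoeff (fun ξ hξ => (hin ξ hξ).memLp) l) ξ₀ hξ₀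
        have h2 := (tendsto_const_nhds
          (x := fourierCoeff (fun x => (V ξ₀ x : ℂ)) l)).sub h1.tendsto
        rw [sub_self] at h2
        refine h2.congr' ?_
        filter_upwards [self_mem_nhdsWithin] with ξ hξ
        rw [e, fourierCoeff_sub (hin ξ₀ hξ₀).memLp (hin ξ hξ).memLp]
      · filter_upwards [self_mem_nhdsWithin] with ξ hξ
        rw [e]
        refine (weightedNorm_sub_le _ (hin ξ₀ hξ₀).memLp (hin ξ hξ).memLp).trans ?_
        push_cast
        exact add_le_add (hM ξ₀ hξ₀) (hM ξ hξ)
    refine ⟨_, hev.and self_mem_nhdsWithin, B + 1, fun ξ hξ => ?_⟩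
    exact (hψ ξ₀ hξ₀).weightedNorm_le_add_one (hψ ξ hξ.2) hw hK hwC (hin ξ₀ hξ₀) (hin ξ hξ.2)
      ((weightedNorm_mono hle _).trans (hM ξ₀ hξ₀)) hξ.1 hB hSδ

end UniformBounds

/-! ### `H^s` bounds, truncation as extension by zero, uniqueness -/

section Final

variable {L : ℝ} [hL : Fact (0 < 2 * L)] {α T : ℝ} {lam : ℕ → ℝ} {v₀ : Torus L → ℝ}
  {v : ℕ → Torus L → ℝ} {V : (ℕ → ℝ) → Torus L → ℝ} {ψin : Torus L → ℂ}
  {ψ : ℝ → (ℕ → ℝ) → Torus L → ℂ} {s : ℝ}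

theorem sobolevNorm_mono {s r : ℝ} (h : s ≤ r) (f : Torus L → ℂ) :
    sobolevNorm s f ≤ sobolevNorm r f := by
  by_cases hf : MemLp f 2 volume
  · rw [sobolevNorm_eq s hf, sobolevNorm_eq r hf]
    gcongr
    exact weightedNorm_mono (sobolevWeight_mono L h) f
  · rw [sobolevNorm, sobolevNorm, if_neg hf, if_neg hf]

theorem weightedNorm_sobolevWeight_le {a : ℝ≥0} {f : Torus L → ℂ} (h : sobolevNorm s f ≤ a) :
    weightedNorm (sobolevWeight L s) f
      ≤ (((ENNReal.ofReal (2 * L) ^ (1 / 2 : ℝ)).toNNReal⁻¹ * a : ℝ≥0) : ℝ≥0∞) := by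
  have hκ := (sobolevNorm_const_pos L).ne'
  have hκ' := sobolevNorm_const_ne_top L
  rw [sobolevNorm_eq s (memLp_of_sobolevNorm_lt_top (h.trans_lt ENNReal.coe_lt_top))] at h
  rw [ENNReal.coe_mul, ENNReal.coe_inv (ENNReal.toNNReal_ne_zero.2 ⟨hκ, hκ'⟩),
    ENNReal.coe_toNNReal hκ', mul_comm _ (a : ℝ≥0∞), ← div_eq_mul_inv,
    ENNReal.le_div_iff_mul_le (Or.inl hκ) (Or.inl hκ'), mul_comm (weightedNorm _ _)]
  exact h

theorem sobolevNorm_le_supNormU (s : ℝ) (V : (ℕ → ℝ) → Torus L → ℝ) {ξ : ℕ → ℝ}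
    (hξ : ξ ∈ paramBox) : sobolevNorm s (fun x => (V ξ x : ℂ)) ≤ supNormU s V :=
  le_iSup₂ (f := fun ξ (_ : ξ ∈ paramBox) => sobolevNorm s (fun x => (V ξ x : ℂ))) ξ hξ

theorem sobolevNorm_le_supNormTU (s : ℝ) (ψ : ℝ → (ℕ → ℝ) → Torus L → ℂ) {t : ℝ}
    (ht : t ∈ Ioo 0 T) {ξ : ℕ → ℝ} (hξ : ξ ∈ paramBox) :
    sobolevNorm s (ψ t ξ) ≤ supNormTU T s ψ :=
  (le_iSup₂ (f := fun ξ (_ : ξ ∈ paramBox) => sobolevNorm s (ψ t ξ)) ξ hξ).trans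
    (le_iSup₂ (f := fun t (_ : t ∈ Ioo 0 T) => ⨆ ξ ∈ paramBox, sobolevNorm s (ψ t ξ)) t ht)

/-- Propagation of `H^s` regularity, uniformly in the parameter. -/
theorem IsKLPotential.supNormTU_lt_top (h : IsKLPotential lam v₀ v V) (hs : 1 ≤ s)
    (hV : supNormU s V < ⊤) (hin : MemSobolev s ψin)
    (hψ : ∀ ξ ∈ paramBox, IsNLSSolution α T (V ξ) ψin (fun t => ψ t ξ)) :
    supNormTU T s ψ < ⊤ := by
  obtain ⟨a, ha⟩ : ∃ a : ℝ≥0, (a : ℝ≥0∞) = supNormU s V := ⟨_, ENNReal.coe_toNNReal hV.ne⟩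
  obtain ⟨K, hK⟩ := exists_embedsInWiener' L
  have hle : ∀ r ≤ s, ∀ ξ ∈ paramBox, sobolevNorm r (fun x => (V ξ x : ℂ)) ≤ a :=
    fun r hr ξ hξ => (sobolevNorm_mono hr _).trans
      ((sobolevNorm_le_supNormU s V hξ).trans ha.symm.le)
  set M := (ENNReal.ofReal (2 * L) ^ (1 / 2 : ℝ)).toNNReal⁻¹ * a
  have hM : ∀ r ≤ s, ∀ ξ ∈ paramBox,
      weightedNorm (sobolevWeight L r) (fun x => (V ξ x : ℂ)) ≤ M :=
    fun r hr ξ hξ => weightedNorm_sobolevWeight_le (hle r hr ξ hξ)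
  have hV1 : ∀ ξ ∈ paramBox, MemSobolev 1 fun x => (V ξ x : ℂ) := fun ξ hξ =>
    (hle 1 hs ξ hξ).trans_lt ENNReal.coe_lt_top
  obtain ⟨B, hB⟩ := h.exists_uniform_bound hV1 (hM 1 hs) hψ
  have hw := sobolevWeight_isAlgebraWeight L (zero_le_one.trans hs)
  set c : ℝ≥0 := 4 ^ (s / 2)
  -- One number dominating both the weighted and the Wiener norm of the potential.
  set M' := max M (K * M)
  have hX : ∃ X : ℝ≥0∞, X ≠ ⊤ ∧ ∀ ξ ∈ paramBox, ∀ t ∈ Icc 0 T,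
      weightedNorm (sobolevWeight L s) (ψ t ξ) ≤ X := by
    refine ⟨(weightedNorm (sobolevWeight L s) ψin + (c * M' * (K * B) /
        (c * M' + ‖α‖₊ * (3 * c ^ 2 * (K * B) ^ 2) + 1) : ℝ≥0)) *
        ENNReal.ofReal (Real.exp ((c * M' + ‖α‖₊ * (3 * c ^ 2 * (K * B) ^ 2) + 1 : ℝ≥0) * T)),
      ENNReal.mul_ne_top (ENNReal.add_ne_top.2 ⟨(weightedNorm_lt_top hin).ne,
        ENNReal.coe_ne_top⟩) ENNReal.ofReal_ne_top, fun ξ hξ t ht => ?_⟩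
    -- Solutions are only known to lie in `H¹`, where the full `H^s` weight may be infinite; the
    -- capped weight is dominated by `N` times the `H¹` weight.
    refine weightedNorm_le_of_forall_min fun N => ?_
    have hmin : ∀ l, min (sobolevWeight L s l) N ≤ sobolevWeight L s l := fun l => min_le_left _ _
    refine ((hψ ξ hξ).weightedNorm_le (hw.min N) (C := N) (fun l => ?_)
      (inWiener_of_memSobolev (hV1 ξ hξ)) (M := M') (B := K * B) ?_ ?_ (fun τ hτ => ?_)
      t ht).trans ?_
    · exact (min_le_right _ _).trans
        (le_mul_of_one_le_right zero_le (one_le_sobolevWeight L zero_le_one l))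
    · exact (weightedNorm_mono hmin _).trans ((hM s le_rfl ξ hξ).trans (by simp [M']))
    · refine (wienerNorm_le hK _).trans ?_
      calc _ ≤ (K : ℝ≥0∞) * M := by gcongr; exact hM _ (by linarith) ξ hξ
        _ ≤ _ := by exact_mod_cast le_max_right M (K * M)
    · refine (wienerNorm_le hK _).trans ?_
      rw [ENNReal.coe_mul]
      gcongr
      exact hB ξ hξ τ (Ioo_subset_Icc_self hτ)
    · gcongr
      exact weightedNorm_mono hmin _
  obtain ⟨X, hX, hb⟩ := hX
  refine lt_of_le_of_lt ?_
    (ENNReal.mul_lt_top (sobolevNorm_const_ne_top L).lt_top hX.lt_top)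
  refine iSup₂_le fun t ht => iSup₂_le fun ξ hξ => ?_
  have ht' := Ioo_subset_Icc_self ht
  rw [sobolevNorm_eq s ((hψ ξ hξ).isSobolevCurve.memLp ht')]
  gcongr
  exact hb ξ hξ t ht'

/-- The parameter that agrees with `ξ` in the first `m` coordinates and vanishes afterwards. -/
def extendByZero (m : ℕ) (ξ : Fin m → ℝ) (j : ℕ) : ℝ := if h : j < m then ξ ⟨j, h⟩ else 0

theorem extendByZero_mem {m : ℕ} {ξ : Fin m → ℝ} (hξ : ξ ∈ paramBoxFin m) :
    extendByZero m ξ ∈ paramBox := fun j => by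
  rw [extendByZero]
  split_ifs with h
  · exact hξ _
  · norm_num

theorem firstCoords_mem {ξ : ℕ → ℝ} (hξ : ξ ∈ paramBox) (m : ℕ) :
    firstCoords m ξ ∈ paramBoxFin m := fun j => hξ j

omit hL in
theorem truncPotential_extendByZero (lam : ℕ → ℝ) (v₀ : Torus L → ℝ) (v : ℕ → Torus L → ℝ)
    {m n : ℕ} (hmn : m ≤ n) (ξ : Fin m → ℝ) :
    truncPotential lam v₀ v n (firstCoords n (extendByZero m ξ)) = truncPotential lam v₀ v m ξ := by
  ext x
  simp only [truncPotential, firstCoords]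
  congr 1
  have e : ∑ j : Fin m, Real.sqrt (lam j) * ξ j * v j x
      = ∑ j : Fin m, Real.sqrt (lam j) * extendByZero m ξ j * v j x :=
    Finset.sum_congr rfl fun j _ => by simp [extendByZero]
  rw [e, ← Finset.sum_range fun j => Real.sqrt (lam j) * extendByZero m ξ j * v j x,
    ← Finset.sum_range fun j => Real.sqrt (lam j) * extendByZero m ξ j * v j x]
  refine (Finset.sum_subset (Finset.range_mono hmn) fun j _ hj => ?_).symm
  have : ¬ j < m := by simpa using hj
  simp [extendByZero, this]

/-- Truncated potentials are values of the full potential. -/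
theorem IsKLPotential.ae_eq_trunc (h : IsKLPotential lam v₀ v V) {m : ℕ} {ξ : Fin m → ℝ}
    (hξ : ξ ∈ paramBoxFin m)
    (hV : AEStronglyMeasurable (V (extendByZero m ξ)) volume) :
    truncPotential lam v₀ v m ξ =ᵐ[volume] V (extendByZero m ξ) := by
  have h1 := h.tendsto _ (extendByZero_mem hξ)
  have h2 : Tendsto (fun n => eLpNorm (truncPotential lam v₀ v n
      (firstCoords n (extendByZero m ξ)) - V (extendByZero m ξ)) 2 volume) atTop
      (𝓝 (eLpNorm (truncPotential lam v₀ v m ξ - V (extendByZero m ξ)) 2 volume)) := by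
    refine tendsto_const_nhds.congr' ?_
    filter_upwards [eventually_ge_atTop m] with n hn
    rw [truncPotential_extendByZero lam v₀ v hn]
  -- Along the extension by zero the partial sums are constant from index `m` on, so their distance
  -- to the limit is zero.
  have h3 := tendsto_nhds_unique h2 h1
  rw [eLpNorm_eq_zero_iff ((h.memLp_trunc m ξ).1.sub hV) two_ne_zero] at h3
  filter_upwards [h3] with x hx
  exact sub_eq_zero.1 hx

/-- Solutions are unique. -/
theorem IsNLSSolution.weightedNorm_sub_eq_zero {W : Torus L → ℝ} {u₀ : Torus L → ℂ}
    {u₁ u₂ : ℝ → Torus L → ℂ} (hu₁ : IsNLSSolution α T W u₀ u₁) (hu₂ : IsNLSSolution α T W u₀ u₂)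
    (hW : MemSobolev 1 fun x => (W x : ℂ)) {t : ℝ} (ht : t ∈ Icc 0 T) :
    weightedNorm (sobolevWeight L 1) (u₁ t - u₂ t) = 0 := by
  obtain ⟨K, hK⟩ := exists_embedsInWiener' L
  have hK := hK.mono (sobolevWeight_mono L (by norm_num : (3 / 4 : ℝ) ≤ 1))
  have hwC : ∀ l, sobolevWeight L 1 l ≤ 1 * sobolevWeight L 1 l := by simp
  obtain ⟨B₁, hB₁⟩ := hu₁.isSobolevCurve.exists_weightedNorm_le hwC
  obtain ⟨B₂, hB₂⟩ := hu₂.isSobolevCurve.exists_weightedNorm_le hwC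
  have hin := inWiener_of_memSobolev hW
  have h := hu₁.weightedNorm_sub_le hu₂ (sobolevWeight_isAlgebraWeight L zero_le_one) hK hwC hin hin
    (M := (weightedNorm (sobolevWeight L 1) fun x => (W x : ℂ)).toNNReal) (B := max B₁ B₂) (δ := 0)
    (by rw [ENNReal.coe_toNNReal (weightedNorm_lt_top hW).ne])
    (by simp [weightedNorm, ell2Norm, fourierCoeff])
    (fun t ht => (hB₁ t (Ioo_subset_Icc_self ht)).trans (by simp))
    (fun t ht => (hB₂ t (Ioo_subset_Icc_self ht)).trans (by simp)) t ht
  simpa using h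

end Final

end

/-! ### The main theorem -/

theorem mainTheorem7 (L : ℝ) [Fact (0 < 2 * L)] (α T : ℝ) (hT : 0 < T) :
    ∃ C : ℝ≥0 → ℝ≥0 → ℝ≥0, (∀ a b, 0 < C a b) ∧
      ∀ (s : ℝ), 1 ≤ s →
      ∀ (lam : ℕ → ℝ) (v₀ : Torus L → ℝ) (v : ℕ → Torus L → ℝ) (V : (ℕ → ℝ) → Torus L → ℝ),
        IsKLPotential lam v₀ v V → supNormU s V < ⊤ →
      ∀ (ψin : Torus L → ℂ), MemSobolev s ψin →
      ∀ (ψ : ℝ → (ℕ → ℝ) → Torus L → ℂ),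
        (∀ ξ ∈ paramBox, IsNLSSolution α T (V ξ) ψin (fun t => ψ t ξ)) →
        supNormTU T s ψ < ⊤ ∧
        ∀ (m : ℕ) (ψm : ℝ → (Fin m → ℝ) → Torus L → ℂ),
          (∀ ξ ∈ paramBoxFin m,
            IsNLSSolution α T (truncPotential lam v₀ v m ξ) ψin (fun t => ψm t ξ)) →
          supNormTU T 1 (fun t ξ => ψm t (firstCoords m ξ) - ψ t ξ) ≤
            C (supNormU s V).toNNReal (supNormTU T s ψ).toNNReal *
              supNormU 1 (fun ξ => truncPotential lam v₀ v m (firstCoords m ξ) - V ξ) := by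
  obtain ⟨K, hK⟩ := exists_embedsInWiener' L
  have hK := hK.mono (sobolevWeight_mono L (by norm_num : (3 / 4 : ℝ) ≤ 1))
  set κ : ℝ≥0 := (ENNReal.ofReal (2 * L) ^ (1 / 2 : ℝ)).toNNReal
  -- Stability is used in `H¹` whatever `s` is, so the algebra constant is `4 ^ (1 / 2)`; `κ⁻¹`
  -- removes the factor `√(2L)` from the norms, and `+ 1` ensures positivity.
  refine ⟨fun a b => stabilityConst α T (4 ^ (1 / 2 : ℝ)) K (κ⁻¹ * a) (κ⁻¹ * b) + 1,
    fun a b => by positivity, ?_⟩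
  intro s hs lam v₀ v V hKL hV ψin hin ψ hψ
  have hfin := hKL.supNormTU_lt_top hs hV hin hψ
  refine ⟨hfin, fun m ψm hψm => ?_⟩
  set a := (supNormU s V).toNNReal with ha
  set b := (supNormTU T s ψ).toNNReal with hb
  have hV1 : ∀ ξ ∈ paramBox, sobolevNorm 1 (fun x => (V ξ x : ℂ)) ≤ a := fun ξ hξ => by
    rw [ha, ENNReal.coe_toNNReal hV.ne]
    exact (sobolevNorm_mono hs _).trans (sobolevNorm_le_supNormU s V hξ)
  have hψ1 : ∀ t ∈ Ioo 0 T, ∀ ξ ∈ paramBox, sobolevNorm 1 (ψ t ξ) ≤ b := fun t ht ξ hξ => by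
    rw [hb, ENNReal.coe_toNNReal hfin.ne]
    exact (sobolevNorm_mono hs _).trans (sobolevNorm_le_supNormTU s ψ ht hξ)
  have hVm : ∀ ξ ∈ paramBox, MemSobolev 1 fun x => (V ξ x : ℂ) := fun ξ hξ =>
    (hV1 ξ hξ).trans_lt ENNReal.coe_lt_top
  have hwC : ∀ l, sobolevWeight L 1 l ≤ 1 * sobolevWeight L 1 l := by simp
  have hae : ∀ ξ ∈ paramBoxFin m,
      truncPotential lam v₀ v m ξ =ᵐ[volume] V (extendByZero m ξ) := fun ξ hξ =>
    hKL.ae_eq_trunc hξ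
      (memLp_of_sobolevNorm_lt_top (hVm _ (extendByZero_mem hξ))).re.1
  -- Uniqueness identifies `ψm` with `ψ` at the extended parameter, so the bound `b` serves both
  -- solutions for every `m`.
  have hψmb : ∀ t ∈ Ioo 0 T, ∀ ξ ∈ paramBoxFin m,
      weightedNorm (sobolevWeight L 1) (ψm t ξ) ≤ (κ⁻¹ * b : ℝ≥0) := fun t ht ξ hξ => by
    have ht' := Ioo_subset_Icc_self ht
    have hξ' := extendByZero_mem hξ
    have hsol := (hψm ξ hξ).congr (hae ξ hξ)
    have h0 := hsol.weightedNorm_sub_eq_zero (hψ _ hξ') (hVm _ hξ') ht'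
    have h1 := weightedNorm_le_add_sub (sobolevWeight L 1) (hsol.isSobolevCurve.memLp ht')
      ((hψ _ hξ').isSobolevCurve.memLp ht')
    rw [h0, add_zero] at h1
    exact h1.trans (weightedNorm_sobolevWeight_le (hψ1 t ht _ hξ'))
  refine iSup₂_le fun t ht => iSup₂_le fun ξ hξ => ?_
  have ht' := Ioo_subset_Icc_self ht
  have hξm := firstCoords_mem hξ m
  have hext := extendByZero_mem hξm
  have haeC : (fun x => (truncPotential lam v₀ v m (firstCoords m ξ) x : ℂ)) =ᵐ[volume]
      fun x => (V (extendByZero m (firstCoords m ξ)) x : ℂ) := by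
    filter_upwards [hae _ hξm] with x hx
    rw [hx]
  have hw₂ := inWiener_of_memSobolev (hVm ξ hξ)
  have hw₁' := inWiener_of_memSobolev (hVm _ hext)
  have hw₁ : InWiener fun x => (truncPotential lam v₀ v m (firstCoords m ξ) x : ℂ) :=
    ⟨(memLp_congr_ae haeC).2 hw₁'.memLp, by rw [wienerNorm_congr haeC]; exact hw₁'.ne_top⟩
  have hM : weightedNorm (sobolevWeight L 1)
      (fun x => (truncPotential lam v₀ v m (firstCoords m ξ) x : ℂ)) ≤ (κ⁻¹ * a : ℝ≥0) := by
    rw [weightedNorm_congr _ haeC]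
    exact weightedNorm_sobolevWeight_le (hV1 _ hext)
  set Δ := weightedNorm (sobolevWeight L 1)
    (fun x => ((truncPotential lam v₀ v m (firstCoords m ξ) - V ξ) x : ℂ)) with hΔ
  have hΔt : Δ ≠ ⊤ := by
    have e : (fun x => ((truncPotential lam v₀ v m (firstCoords m ξ) - V ξ) x : ℂ))
        = (fun x => (truncPotential lam v₀ v m (firstCoords m ξ) x : ℂ))
          - fun x => (V ξ x : ℂ) := by ext x; simp
    rw [hΔ, e]
    exact ne_top_of_le_ne_top (ENNReal.add_ne_top.2
      ⟨ne_top_of_le_ne_top ENNReal.coe_ne_top hM, (weightedNorm_lt_top (hVm ξ hξ)).ne⟩)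
      (weightedNorm_sub_le _ hw₁.memLp hw₂.memLp)
  have hstab := (hψm _ hξm).weightedNorm_sub_le (hψ ξ hξ)
    (sobolevWeight_isAlgebraWeight L zero_le_one) hK hwC hw₁ hw₂ (δ := Δ.toNNReal) hM
    (by rw [ENNReal.coe_toNNReal hΔt]) (fun t ht => hψmb t ht _ hξm)
    (fun t ht => weightedNorm_sobolevWeight_le (hψ1 t ht ξ hξ)) t ht'
  rw [ENNReal.coe_toNNReal hΔt] at hstab
  have hm1 := (hψm _ hξm).isSobolevCurve.memLp ht'
  have hm2 := (hψ ξ hξ).isSobolevCurve.memLp ht'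
  calc sobolevNorm 1 (ψm t (firstCoords m ξ) - ψ t ξ)
      = ENNReal.ofReal (2 * L) ^ (1 / 2 : ℝ) *
        weightedNorm (sobolevWeight L 1) (ψm t (firstCoords m ξ) - ψ t ξ) :=
        sobolevNorm_eq 1 (hm1.sub hm2)
    _ ≤ ENNReal.ofReal (2 * L) ^ (1 / 2 : ℝ) * (stabilityConst α T (4 ^ (1 / 2 : ℝ)) K (κ⁻¹ * a)
        (κ⁻¹ * b) * Δ) := by gcongr
    _ = stabilityConst α T (4 ^ (1 / 2 : ℝ)) K (κ⁻¹ * a) (κ⁻¹ * b) *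
        sobolevNorm 1 (fun x => ((truncPotential lam v₀ v m (firstCoords m ξ) - V ξ) x : ℂ)) := by
        rw [sobolevNorm_eq 1 (hw₁.real_sub hw₂).memLp]
        ring
    _ ≤ _ := by
        refine mul_le_mul' (by exact_mod_cast le_self_add) ?_
        exact sobolevNorm_le_supNormU 1
          (fun ξ => truncPotential lam v₀ v m (firstCoords m ξ) - V ξ) hξ
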